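/- All graphs are finite and simple. A separation of a graph $G$ is a pair $(A,B)$ of subgraphs of $G$ with $A\cup B=G$ and $E(A\cap B)=\emptyset$. A graph is drawn in a space by representing its vertices by distinct points and each edge by a simple arc joining its ends, such that the interiors of these arcs contain no vertices and are pairwise disjoint; a graph is planar if it can be drawn in the plane. **Theorem 5.3.** Let $(A,B)$ be a separation of a graph $G$. Let $B$ be drawn in a closed disc $D$, and let the vertices of $B$ drawn in the boundary of $D$ be $v_1,\dots,v_T$ (distinct), in this cyclic order. Let $1\le t\le T$, and suppose that - every edge of $B$ is drawn, except for its ends, in the interior of $D$; - $V(A\cap B)=\{v_t,v_{t+1},\dots,v_T,v_1\}$; - there are paths $P_1,P_2,P_3$ of $G$, pairwise vertex-disjoint, where $P_i$ has ends $v_i$ and $v_{t+1-i}$ for $i=1,2,3$; $P_1$ is a path of $A\cup B$, and $P_2,P_3$ are paths of $B$; - every vertex of $A\cap B$ belongs to $P_1$; - there exist integers $3\le a<b<c<d\le t-2$ such that there are two vertex-disjoint paths $Q,R$ of $G$, where $Q$ has ends $v_a,v_c$ and $R$ has ends $v_b,v_d$. Then $G$ is not planar. -/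

import Mathlib

/-- A drawing of the graph `G` in the topological space `X`: vertices are distinct points, every
edge is a simple arc (an injective path, the same one traversed backwards when the ends are
swapped) between its two ends, the interior of an arc contains no vertex, and the interiors of the
arcs of two different edges are disjoint. -/
structure GraphDrawing {V : Type*} (G : SimpleGraph V) (X : Type*) [TopologicalSpace X] where
  /-- the point that represents a vertex -/
  pos : V → X
  pos_injective : Function.Injective pos
  /-- the arc that represents an edge -/
  arc : ∀ u w : V, G.Adj u w → Path (pos u) (pos w)
  arc_symm : ∀ (u w : V) (h : G.Adj u w), arc w u h.symm = (arc u w h).symm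
  arc_injective : ∀ (u w : V) (h : G.Adj u w), Function.Injective (arc u w h)
  pos_notMem_arc : ∀ (u w : V) (h : G.Adj u w) (x : V),
    pos x ∉ arc u w h '' Set.Ioo (0 : unitInterval) 1
  arc_disjoint : ∀ (u w : V) (h : G.Adj u w) (u' w' : V) (h' : G.Adj u' w'),
    s(u, w) ≠ s(u', w') →
      Disjoint (arc u w h '' Set.Ioo (0 : unitInterval) 1)
        (arc u' w' h' '' Set.Ioo (0 : unitInterval) 1)

/-- A graph is planar if it has a drawing in the plane (here `ℂ`, with its usual topology). -/
def IsPlanarGraph {V : Type*} (G : SimpleGraph V) : Prop :=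
  Nonempty (GraphDrawing G ℂ)

/-- The closed unit disc. A closed disc is a space `D` with a homeomorphism
`φ : UnitDisc ≃ₜ D`; its boundary is the image of the unit circle and its interior the image of
the open unit disc. -/
abbrev UnitDisc : Type := Metric.closedBall (0 : ℂ) 1

namespace GraphDrawing

variable {V D : Type*} [TopologicalSpace D] {G : SimpleGraph V}

/-- The arcs of all edges, without their ends, lie in the interior of the closed disc `D`. -/
def EdgesInInterior (δ : GraphDrawing G D) (φ : UnitDisc ≃ₜ D) : Prop :=
  ∀ (u w : V) (h : G.Adj u w), ∀ s ∈ Set.Ioo (0 : unitInterval) 1,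
    ‖(φ.symm (δ.arc u w h s) : ℂ)‖ < 1

/-- The vertices drawn in the boundary of the closed disc `D` are precisely `v 1, …, v T`, which are
distinct and occur there in this (cyclic) order: their angles increase and stay within one turn.
(The reverse orientation is covered by composing `φ` with a reflection of the unit disc.) -/
def BoundaryInOrder (δ : GraphDrawing G D) (φ : UnitDisc ≃ₜ D) (T : ℕ) (v : ℕ → V) : Prop :=
  (∃ θ : ℕ → ℝ, StrictMonoOn θ (Set.Icc 1 T) ∧ θ T < θ 1 + 2 * Real.pi ∧
    ∀ i ∈ Set.Icc 1 T, (φ.symm (δ.pos (v i)) : ℂ) = Complex.exp (θ i * Complex.I)) ∧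
  ∀ x : V, ‖(φ.symm (δ.pos x) : ℂ)‖ = 1 → ∃ i ∈ Set.Icc 1 T, v i = x

end GraphDrawing

/-- `(A, B)` is a separation of `G`: `A ∪ B = G` and `A`, `B` have no edge in common. -/
def IsGraphSeparation {V : Type*} {G : SimpleGraph V} (A B : G.Subgraph) : Prop :=
  A ⊔ B = ⊤ ∧ (A ⊓ B).edgeSet = ∅

/-! ### Continuous logarithms and the turning of a path around the origin -/

open scoped unitInterval

/-! Cut the boundary of the disc between `v 1` and `v 2`. The boundary vertices then form a line `w
2, …, w (T + 1)` with `w (T + 1) = v 1`, and `Z = V(A ∩ B)` is its final segment from index `t` on.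
The drawing of `B` enters only through cross-freeness (`IsCrossFree`): disjoint connected sets of
`B` cannot join interleaved pairs of this line. Write `p` and `g` for the second and third given
path.

Both crossing paths must meet `Z`, since otherwise `B` would contain a cross. Starting from `w a`
and from `w d`, each of them meets `g` and reaches `p` before `Z` (`exists_leg`). These two legs and
the part of `p` between their feet form a path of `B`, the frame, which separates `w b` and `w c`
from `Z` in `B`. So each crossing path meets `Z` only in excursions that start and end on the
frame's part of `p`. On each excursion, replace the stretch between its first and last vertex of
`Z`, which may run through `A`, by a virtual edge (`joinedWithin_spanGraph`). If no virtual edge of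
one path interleaves with one of the other, these edges can be drawn as semicircles outside the
disc, and the two paths still form an impossible cross (`HalfPlaneDrawing.false_of_interleaved`).

Hence two excursions interleave on `Z`. By cross-freeness their four feet lie on `p` in the opposite
order, and together with `P₁`, `p` and a detour along the legs and a piece of `g` they form a `K₃,₃`
(`IsFrame.not_isPlanarGraph`).

The topology is a winding argument: the difference of two disjoint paths is a nonvanishing function
on a square and so has a continuous logarithm. This yields both the crossing lemma in a half plane
and the nonplanarity of `K₃,₃`. -/

theorem exists_continuous_log {A : Type*} [TopologicalSpace A] [SimplyConnectedSpace A]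
    [LocallyPathConnectedSpace A] {f : A → ℂ} (hf : Continuous f) (h0 : ∀ x, f x ≠ 0) :
    ∃ g : A → ℂ, Continuous g ∧ ∀ x, Complex.exp (g x) = f x := by
  obtain ⟨a₀⟩ : Nonempty A := inferInstance
  obtain ⟨F, ⟨-, hF⟩, -⟩ := Complex.isCoveringMapOn_exp.existsUnique_continuousMap_lifts
    ⟨f, hf⟩ (a₀ := a₀) (e₀ := Complex.log (f a₀)) (Complex.exp_log (h0 a₀)) (fun a => h0 a)
  exact ⟨F, F.continuous, fun x => congrFun hF x⟩

/-- Clamping coordinates extends `f` to all of `ℝ × ℝ`, where lifting through the covering `exp`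
applies. -/
theorem exists_continuous_log_square {f : I × I → ℂ} (hf : Continuous f) (h0 : ∀ x, f x ≠ 0) :
    ∃ g : I × I → ℂ, Continuous g ∧ ∀ x, Complex.exp (g x) = f x := by
  obtain ⟨g, hg, hgf⟩ := exists_continuous_log (A := ℝ × ℝ)
    (f := fun x => f (Set.projIcc 0 1 zero_le_one x.1, Set.projIcc 0 1 zero_le_one x.2))
    (hf.comp ((continuous_projIcc.comp continuous_fst).prodMk
      (continuous_projIcc.comp continuous_snd))) (fun x => h0 _)
  refine ⟨fun x => g (x.1, x.2), by fun_prop, fun x => ?_⟩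
  rw [hgf]
  simp

theorem exists_continuous_log_path {f : I → ℂ} (hf : Continuous f) (h0 : ∀ x, f x ≠ 0) :
    ∃ g : I → ℂ, Continuous g ∧ ∀ x, Complex.exp (g x) = f x := by
  obtain ⟨g, hg, hgf⟩ := exists_continuous_log_square (f := fun x => f x.1)
    (by fun_prop) (fun x => h0 _)
  exact ⟨fun x => g (x, 0), by fun_prop, fun x => hgf _⟩

/-- Two continuous logarithms of the same path change by the same amount. -/
theorem sub_eq_sub_of_exp_eq {g h : I → ℂ} (hg : Continuous g) (hh : Continuous h)
    (e : ∀ x, Complex.exp (g x) = Complex.exp (h x)) : g 1 - g 0 = h 1 - h 0 := by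
  have key : ∀ x, ∃ n : ℤ, (g x - h x) / (2 * Real.pi * Complex.I) = n := by
    intro x
    obtain ⟨n, hn⟩ := Complex.exp_eq_exp_iff_exists_int.1 (e x)
    refine ⟨n, ?_⟩
    rw [hn, add_sub_cancel_left, mul_div_assoc, div_self Complex.two_pi_I_ne_zero, mul_one]
  choose n hn using key
  have hcont : Continuous n := by
    have h1 : Continuous fun x => (n x : ℂ) := by
      have : (fun x => (n x : ℂ)) = fun x => (g x - h x) / (2 * Real.pi * Complex.I) :=
        funext fun x => (hn x).symm
      rw [this]; fun_prop
    have h2 : Continuous fun x => (n x : ℝ) := by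
      have := Complex.continuous_re.comp h1
      simpa [Function.comp_def] using this
    exact Int.isClosedEmbedding_coe_real.isEmbedding.continuous_iff.2 h2
  have h01 : n 1 = n 0 := PreconnectedSpace.constant inferInstance hcont
  have h1 := hn 1
  have h0 := hn 0
  rw [h01, ← h0] at h1
  have := (div_left_inj' Complex.two_pi_I_ne_zero).1 h1
  linear_combination this

open Classical in
/-- The total change of a continuous logarithm along a path in the punctured plane. -/
noncomputable def logTurn (f : I → ℂ) : ℂ :=
  if h : ∃ g : I → ℂ, Continuous g ∧ ∀ x, Complex.exp (g x) = f x then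
    h.choose 1 - h.choose 0 else 0

theorem logTurn_eq {f g : I → ℂ} (hg : Continuous g) (h : ∀ x, Complex.exp (g x) = f x) :
    logTurn f = g 1 - g 0 := by
  have H : ∃ g : I → ℂ, Continuous g ∧ ∀ x, Complex.exp (g x) = f x := ⟨g, hg, h⟩
  rw [logTurn, dif_pos H]
  exact sub_eq_sub_of_exp_eq H.choose_spec.1 hg fun x => by rw [H.choose_spec.2, h]

theorem logTurn_neg {f : I → ℂ} (hf : Continuous f) (h0 : ∀ x, f x ≠ 0) :
    logTurn (fun x => -f x) = logTurn f := by
  obtain ⟨g, hg, h⟩ := exists_continuous_log_path hf h0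
  rw [logTurn_eq hg h, logTurn_eq (g := fun x => g x + Real.pi * Complex.I) (by fun_prop)]
  · ring
  · intro x
    rw [Complex.exp_add, h, Complex.exp_pi_mul_I]; ring

theorem exists_logTurn_eq {f : I → ℂ} (hf : Continuous f) (h0 : ∀ x, f x ≠ 0) {u v : ℂ}
    (hu : Complex.exp u = f 0) (hv : Complex.exp v = f 1) :
    ∃ n : ℤ, logTurn f = v - u + n * (2 * Real.pi * Complex.I) := by
  obtain ⟨g, hg, h⟩ := exists_continuous_log_path hf h0
  obtain ⟨n, hn⟩ := Complex.exp_eq_exp_iff_exists_int.1 (hu.trans (h 0).symm)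
  obtain ⟨m, hm⟩ := Complex.exp_eq_exp_iff_exists_int.1 (hv.trans (h 1).symm)
  refine ⟨n - m, ?_⟩
  rw [logTurn_eq hg h, hn, hm]
  push_cast; ring

theorem logTurn_square {f : I × I → ℂ} (hf : Continuous f) (h0 : ∀ x, f x ≠ 0) :
    logTurn (fun t => f (0, t)) + logTurn (fun s => f (s, 1)) =
      logTurn (fun s => f (s, 0)) + logTurn (fun t => f (1, t)) := by
  obtain ⟨g, hg, h⟩ := exists_continuous_log_square hf h0
  rw [logTurn_eq (g := fun t => g (0, t)) (by fun_prop) (fun x => h _),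
    logTurn_eq (g := fun t => g (t, 1)) (by fun_prop) (fun x => h _),
    logTurn_eq (g := fun t => g (t, 0)) (by fun_prop) (fun x => h _),
    logTurn_eq (g := fun t => g (1, t)) (by fun_prop) (fun x => h _)]
  ring

/-- On the negative real axis the principal logarithm takes its limit from above, so the closed
upper half plane without the origin causes no jump. The lower half plane is reduced to this one by
negation. -/
theorem continuousOn_log_upperHalf : ContinuousOn Complex.log {z | 0 ≤ z.im ∧ z ≠ 0} := by
  rintro z ⟨hz, hz0⟩
  by_cases h : z ∈ Complex.slitPlane
  · exact (continuousAt_clog h).continuousWithinAt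
  · rw [Complex.mem_slitPlane_iff, not_or, not_lt, not_not] at h
    have hre : z.re < 0 := lt_of_le_of_ne h.1 fun h' => hz0 (Complex.ext h' h.2)
    exact (Complex.continuousWithinAt_log_of_re_neg_of_im_zero hre h.2).mono fun w hw => hw.1

theorem logTurn_of_im_nonneg {f : I → ℂ} (hf : Continuous f) (h0 : ∀ x, f x ≠ 0)
    (him : ∀ x, 0 ≤ (f x).im) : logTurn f = Complex.log (f 1) - Complex.log (f 0) :=
  logTurn_eq (g := fun x => Complex.log (f x))
    (continuousOn_log_upperHalf.comp_continuous hf fun x => ⟨him x, h0 x⟩)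
    fun x => Complex.exp_log (h0 x)

theorem logTurn_of_im_nonpos {f : I → ℂ} (hf : Continuous f) (h0 : ∀ x, f x ≠ 0)
    (him : ∀ x, (f x).im ≤ 0) : logTurn f = Complex.log (-f 1) - Complex.log (-f 0) := by
  rw [← logTurn_neg hf h0]
  exact logTurn_of_im_nonneg hf.neg (fun x => neg_ne_zero.2 (h0 x)) fun x => by
    simpa using him x

/-! ### Crossing paths in a half plane and nonplanarity of `K₃,₃` -/

/-- Two paths in a closed upper half plane whose ends interleave on the boundary line meet. -/
theorem exists_eq_of_interleaved {m a b c d : ℝ} (hab : a < b) (hbc : b < c) (hcd : c < d)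
    (α : Path (⟨a, m⟩ : ℂ) ⟨c, m⟩) (β : Path (⟨b, m⟩ : ℂ) ⟨d, m⟩)
    (hα : ∀ s, m ≤ (α s).im) (hβ : ∀ s, m ≤ (β s).im) : ∃ s t, α s = β t := by
  by_contra! H
  have hne : ∀ s t, α s - β t ≠ 0 := fun s t => sub_ne_zero.2 (H s t)
  -- On each side of the square one of the two points is fixed on the boundary line, so the
  -- difference stays in a closed half plane and principal logarithms compute its turning. The two
  -- routes between opposite corners turn by `0` and by `-2π`.
  have hsq := logTurn_square (f := fun x => α x.1 - β x.2) (by fun_prop) (fun x => hne _ _)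
  simp only at hsq
  rw [logTurn_of_im_nonpos (by fun_prop) (fun x => hne _ _) (by simpa using hβ),
    logTurn_of_im_nonneg (by fun_prop) (fun x => hne _ _) (by simpa using hα),
    logTurn_of_im_nonneg (by fun_prop) (fun x => hne _ _) (by simpa using hα),
    logTurn_of_im_nonpos (by fun_prop) (fun x => hne _ _) (by simpa using hβ)] at hsq
  have e : ∀ x y : ℝ, (⟨x, m⟩ : ℂ) - ⟨y, m⟩ = ((x - y : ℝ) : ℂ) := fun x y => by
    apply Complex.ext <;> simp
  simp only [Path.source, Path.target, e, ← Complex.ofReal_neg, neg_sub] at hsq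
  have hpos : ∀ x y : ℝ, x < y → (Complex.log ((y - x : ℝ) : ℂ)).im = 0 := fun x y h => by
    rw [Complex.log_im, Complex.arg_ofReal_of_nonneg (by linarith)]
  have hneg : ∀ x y : ℝ, x < y → (Complex.log ((x - y : ℝ) : ℂ)).im = Real.pi := fun x y h => by
    rw [Complex.log_im, Complex.arg_ofReal_of_neg (by linarith)]
  have := congrArg Complex.im hsq
  simp only [Complex.add_im, Complex.sub_im, hpos a b hab, hpos a d (by linarith),
    hneg a b hab, hneg a d (by linarith), hpos b c hbc, hneg b c hbc, hpos c d hcd,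
    hneg c d hcd] at this
  linarith [Real.pi_pos]

/-- In a plane drawing of `K₃,₃` with continuous arcs, two disjoint edges have arcs that meet. -/
theorem exists_eq_of_completeBipartite (a b : Fin 3 → ℂ) (γ : ∀ i j, Path (a i) (b j)) :
    ∃ i k j l, i ≠ k ∧ j ≠ l ∧ ∃ s t, γ i j s = γ k l t := by
  by_contra! H
  have hne : ∀ i j k l s t, i ≠ k → j ≠ l → γ i j s - γ k l t ≠ 0 :=
    fun i j k l s t hik hjl => sub_ne_zero.2 (H i k j l hik hjl s t)
  have haf : ∀ i k l t, i ≠ k → a i - γ k l t ≠ 0 := fun i k l t hik => by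
    obtain ⟨j, hj⟩ := exists_ne l
    simpa using hne i j k l 0 t hik hj
  have hbf : ∀ j k l t, j ≠ l → b j - γ k l t ≠ 0 := fun j k l t hjl => by
    obtain ⟨i, hi⟩ := exists_ne k
    simpa using hne i j k l 1 t hi hjl
  have hab : ∀ i j, a i - b j ≠ 0 := fun i j => by
    obtain ⟨k, hk⟩ := exists_ne i
    simpa using haf i k j 1 hk.symm
  have haa : ∀ i k, i ≠ k → a i - a k ≠ 0 := fun i k h => by simpa using haf i k 0 0 h
  have hbb : ∀ i k, i ≠ k → b i - b k ≠ 0 := fun i k h => by simpa using hbf i 0 k 1 h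
  have hexp : ∀ z : ℂ, Complex.exp (z + Real.pi * Complex.I) = -Complex.exp z := fun z => by
    rw [Complex.exp_add, Complex.exp_pi_mul_I]; ring
  let A : Fin 3 → Fin 3 → ℂ := fun i j => Complex.log (a i - b j)
  -- Logarithms of opposite differences are fixed to differ by exactly `π * I`. Every turning along
  -- an edge is then a difference of fixed logarithms up to an integer multiple of `2 * π * I`.
  let C : Fin 3 → Fin 3 → ℂ := fun i k =>
    if i < k then Complex.log (a i - a k) else Complex.log (a k - a i) + Real.pi * Complex.I
  let D : Fin 3 → Fin 3 → ℂ := fun i k =>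
    if i < k then Complex.log (b i - b k) else Complex.log (b k - b i) + Real.pi * Complex.I
  have hA : ∀ i j, Complex.exp (A i j) = a i - b j := fun i j => Complex.exp_log (hab i j)
  have hC : ∀ i k, i ≠ k → Complex.exp (C i k) = a i - a k := fun i k h => by
    by_cases h' : i < k
    · simp only [C, if_pos h', Complex.exp_log (haa i k h)]
    · simp only [C, if_neg h', hexp, Complex.exp_log (haa k i h.symm)]; ring
  have hD : ∀ i k, i ≠ k → Complex.exp (D i k) = b i - b k := fun i k h => by
    by_cases h' : i < k
    · simp only [D, if_pos h', Complex.exp_log (hbb i k h)]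
    · simp only [D, if_neg h', hexp, Complex.exp_log (hbb k i h.symm)]; ring
  have hm : ∀ i k l, ∃ m : ℤ, i ≠ k → logTurn (fun t => a i - γ k l t) =
      A i l - C i k + m * (2 * Real.pi * Complex.I) := fun i k l => by
    by_cases h : i = k
    · exact ⟨0, fun h' => (h' h).elim⟩
    · obtain ⟨m, hm⟩ := exists_logTurn_eq (f := fun t => a i - γ k l t) (by fun_prop)
        (fun t => haf i k l t h) (u := C i k) (v := A i l) (by simp [hC i k h]) (by simp [hA])
      exact ⟨m, fun _ => hm⟩
  have hn : ∀ j k l, ∃ m : ℤ, j ≠ l → logTurn (fun t => b j - γ k l t) =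
      D j l - (A k j + Real.pi * Complex.I) + m * (2 * Real.pi * Complex.I) := fun j k l => by
    by_cases h : j = l
    · exact ⟨0, fun h' => (h' h).elim⟩
    · obtain ⟨m, hm⟩ := exists_logTurn_eq (f := fun t => b j - γ k l t) (by fun_prop)
        (fun t => hbf j k l t h) (u := A k j + Real.pi * Complex.I) (v := D j l)
        (by simp [hexp, hA]) (by simp [hD j l h])
      exact ⟨m, fun _ => hm⟩
  choose m hm using hm
  choose n hn using hn
  have key : ∀ i k j l, i < k → j ≠ l →
      m i k l + n l i j - m k i j - n j k l = if j < l then -1 else 0 := by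
    intro i k j l hik hjl
    have hsq := logTurn_square (f := fun x => γ i j x.1 - γ k l x.2) (by fun_prop)
      (fun x => hne i j k l _ _ hik.ne hjl)
    simp only [Path.source, Path.target] at hsq
    have e1 : logTurn (fun s => γ i j s - b l) = logTurn (fun s => b l - γ i j s) := by
      rw [← logTurn_neg (by fun_prop) (fun s => hbf l i j s hjl.symm)]
      simp
    have e2 : logTurn (fun s => γ i j s - a k) = logTurn (fun s => a k - γ i j s) := by
      rw [← logTurn_neg (by fun_prop) (fun s => haf k i j s hik.ne')]
      simp
    rw [e1, e2, hm i k l hik.ne, hm k i j hik.ne', hn l i j hjl.symm, hn j k l hjl] at hsq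
    have hCC : C k i = C i k + Real.pi * Complex.I := by
      simp only [C, if_pos hik, if_neg hik.not_gt]
    have hfin : ((m i k l + n l i j - m k i j - n j k l : ℤ) : ℂ) =
        ((if j < l then -1 else 0 : ℤ) : ℂ) := by
      apply mul_right_cancel₀ Complex.two_pi_I_ne_zero
      rcases lt_or_gt_of_ne hjl with h | h
      · have hDD : D l j = D j l + Real.pi * Complex.I := by
          simp only [D, if_pos h, if_neg h.not_gt]
        rw [if_pos h]
        push_cast
        linear_combination hsq - hCC - hDD
      · have hDD : D j l = D l j + Real.pi * Complex.I := by
          simp only [D, if_pos h, if_neg h.not_gt]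
        rw [if_neg h.not_gt]
        push_cast
        linear_combination hsq - hCC + hDD
    exact_mod_cast hfin
  have k01 : (0 : Fin 3) < 1 := by decide
  have k02 : (0 : Fin 3) < 2 := by decide
  have k12 : (1 : Fin 3) < 2 := by decide
  have E := fun i k h => And.intro (key i k 0 1 h (by decide)) <|
    And.intro (key i k 0 2 h (by decide)) <| And.intro (key i k 1 0 h (by decide)) <|
    And.intro (key i k 1 2 h (by decide)) <| And.intro (key i k 2 0 h (by decide))
      (key i k 2 1 h (by decide))
  have E1 := E 0 1 k01
  have E2 := E 0 2 k02
  have E3 := E 1 2 k12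
  simp (decide := true) only [if_true, if_false] at E1 E2 E3
  -- The 18 equations contradict each other modulo 2. Each `m` and each `n` pairs a vertex with an
  -- edge and occurs in exactly two equations, so the left sides sum to an even number, but the
  -- right sides sum to `-9`.
  omega

/-! ### Walks confined to a vertex set, and the points drawn for them -/

namespace SimpleGraph

variable {V : Type*} {H H' : SimpleGraph V} {X Y : Set V} {u v w : V}

/-- Two vertices are joined by a walk of `H` all of whose vertices lie in `X`. -/
def JoinedWithin (H : SimpleGraph V) (X : Set V) (u v : V) : Prop :=
  ∃ p : H.Walk u v, ∀ z ∈ p.support, z ∈ X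

theorem JoinedWithin.refl (hu : u ∈ X) : H.JoinedWithin X u u :=
  ⟨.nil, by simpa using hu⟩

theorem JoinedWithin.symm (h : H.JoinedWithin X u v) : H.JoinedWithin X v u := by
  obtain ⟨p, hp⟩ := h
  exact ⟨p.reverse, fun z hz => hp z (by simpa using hz)⟩

theorem JoinedWithin.trans (h : H.JoinedWithin X u v) (h' : H.JoinedWithin X v w) :
    H.JoinedWithin X u w := by
  obtain ⟨p, hp⟩ := h
  obtain ⟨q, hq⟩ := h'
  exact ⟨p.append q, fun z hz => ((Walk.mem_support_append_iff _ _).1 hz).elim (hp z) (hq z)⟩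

theorem JoinedWithin.mono (h : H.JoinedWithin X u v) (hXY : X ⊆ Y) : H.JoinedWithin Y u v := by
  obtain ⟨p, hp⟩ := h
  exact ⟨p, fun z hz => hXY (hp z hz)⟩

theorem JoinedWithin.mono_graph (h : H.JoinedWithin X u v) (hHH : H ≤ H') :
    H'.JoinedWithin X u v := by
  obtain ⟨p, hp⟩ := h
  exact ⟨p.mapLe hHH, fun z hz => hp z (by simpa using hz)⟩

theorem JoinedWithin.of_adj (h : H.Adj u v) (hu : u ∈ X) (hv : v ∈ X) : H.JoinedWithin X u v :=
  ⟨h.toWalk, by simp [hu, hv]⟩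

theorem JoinedWithin.left_mem (h : H.JoinedWithin X u v) : u ∈ X := by
  obtain ⟨p, hp⟩ := h
  exact hp u p.start_mem_support

theorem JoinedWithin.right_mem (h : H.JoinedWithin X u v) : v ∈ X := h.symm.left_mem

/-- Along a walk within `X`, a relation that is transitive on `X` and contains the edges holds. -/
theorem JoinedWithin.rec_rel {R : V → V → Prop} (h : H.JoinedWithin X u v)
    (hrefl : ∀ x ∈ X, R x x) (hstep : ∀ x y z, x ∈ X → y ∈ X → H.Adj x y → R y z → R x z) :
    R u v := by
  obtain ⟨p, hp⟩ := h
  induction p with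
  | nil => exact hrefl _ (hp _ (by simp))
  | cons hadj p ih =>
    simp only [Walk.support_cons, List.mem_cons, forall_eq_or_imp] at hp
    exact hstep _ _ _ hp.1 (hp.2 _ p.start_mem_support) hadj (ih hp.2)

end SimpleGraph

namespace GraphDrawing

variable {V S : Type*} [TopologicalSpace S] {G : SimpleGraph V} (δ : GraphDrawing G S)

/-- The set of points drawn for the subgraph induced on `X`. -/
def trace (X : Set V) : Set S :=
  {q | (∃ u ∈ X, δ.pos u = q) ∨
    ∃ (u w : V) (h : G.Adj u w), u ∈ X ∧ w ∈ X ∧ ∃ s ∈ Set.Ioo (0 : I) 1, δ.arc u w h s = q}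

theorem pos_mem_trace {X : Set V} {u : V} (hu : u ∈ X) : δ.pos u ∈ δ.trace X := .inl ⟨u, hu, rfl⟩

theorem trace_mono {X Y : Set V} (h : X ⊆ Y) : δ.trace X ⊆ δ.trace Y := by
  rintro q (⟨u, hu, rfl⟩ | ⟨u, w, e, hu, hw, s, hs, rfl⟩)
  · exact .inl ⟨u, h hu, rfl⟩
  · exact .inr ⟨u, w, e, h hu, h hw, s, hs, rfl⟩

theorem mem_of_pos_mem_trace {X : Set V} {u : V} (hu : δ.pos u ∈ δ.trace X) : u ∈ X := by
  rcases hu with ⟨u', hu', e⟩ | ⟨x, y, h, -, -, s, hs, e⟩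
  · rwa [← δ.pos_injective e]
  · exact (δ.pos_notMem_arc x y h u ⟨s, hs, e⟩).elim

/-- Interiors of arcs contain no vertices, and a common interior point forces the two edges to be
equal; their ends would then lie in both `X` and `Y`. -/
theorem disjoint_trace {X Y : Set V} (h : Disjoint X Y) : Disjoint (δ.trace X) (δ.trace Y) := by
  rw [Set.disjoint_left] at h ⊢
  rintro q (⟨u, hu, rfl⟩ | ⟨u, w, e, hu, hw, s, hs, rfl⟩) hY
  · exact h hu (δ.mem_of_pos_mem_trace hY)
  · rcases hY with ⟨u', hu', e'⟩ | ⟨u', w', e', hu', hw', s', hs', hq⟩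
    · exact δ.pos_notMem_arc u w e u' ⟨s, hs, e'.symm⟩
    · refine Set.disjoint_left.1 (δ.arc_disjoint u w e u' w' e' ?_) ⟨s, hs, rfl⟩ ⟨s', hs', hq⟩
      intro heq
      rcases Sym2.eq_iff.1 heq with ⟨rfl, -⟩ | ⟨rfl, -⟩
      · exact h hu hu'
      · exact h hu hw'

theorem joinedIn_trace_of_adj {X : Set V} {u w : V} (h : G.Adj u w) (hu : u ∈ X) (hw : w ∈ X) :
    JoinedIn (δ.trace X) (δ.pos u) (δ.pos w) := by
  refine ⟨δ.arc u w h, fun s => ?_⟩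
  by_cases h0 : s = 0
  · rw [h0, Path.source]; exact δ.pos_mem_trace hu
  by_cases h1 : s = 1
  · rw [h1, Path.target]; exact δ.pos_mem_trace hw
  exact .inr ⟨u, w, h, hu, hw, s,
    ⟨unitInterval.pos_iff_ne_zero.2 h0, unitInterval.lt_one_iff_ne_one.2 h1⟩, rfl⟩

theorem joinedIn_trace {X : Set V} {u w : V} (h : G.JoinedWithin X u w) :
    JoinedIn (δ.trace X) (δ.pos u) (δ.pos w) :=
  h.rec_rel (R := fun u w => JoinedIn (δ.trace X) (δ.pos u) (δ.pos w))
    (fun _ hx => JoinedIn.refl (δ.pos_mem_trace hx))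
    fun _ _ _ hx hy hxy hyz => (δ.joinedIn_trace_of_adj hxy hx hy).trans hyz

end GraphDrawing

/-- A graph with a `K₃,₃` whose edges are modelled by connected vertex sets, disjoint for disjoint
edges, is not planar. -/
theorem not_isPlanarGraph_of_completeBipartite {V : Type*} {G : SimpleGraph V} (a b : Fin 3 → V)
    (E : Fin 3 → Fin 3 → Set V) (hE : ∀ i j, G.JoinedWithin (E i j) (a i) (b j))
    (hd : ∀ i k j l, i < k → j ≠ l → Disjoint (E i j) (E k l)) : ¬ IsPlanarGraph G := by
  rintro ⟨δ⟩
  have hJ := fun i j => δ.joinedIn_trace (hE i j)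
  choose γ hγ using hJ
  obtain ⟨i, k, j, l, hik, hjl, s, t, hst⟩ := exists_eq_of_completeBipartite _ _ γ
  have hE' : Disjoint (E i j) (E k l) := by
    rcases lt_or_gt_of_ne hik with h | h
    · exact hd i k j l h hjl
    · exact (hd k i l j h hjl.symm).symm
  exact Set.disjoint_left.1 (δ.disjoint_trace hE') (hγ i j s) (hst ▸ hγ k l t)

/-! ### Half plane drawings with additional edges below the boundary line -/

/-- The semicircle in the lower half plane over the segment `[x, y]` of the real line. -/
def lowerSemicircle (x y : ℝ) : Set ℂ := {z | z.im ≤ 0 ∧ (z.re - x) * (z.re - y) + z.im ^ 2 = 0}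

theorem re_mem_of_mem_lowerSemicircle {x y : ℝ} (hxy : x < y) {z : ℂ}
    (hz : z ∈ lowerSemicircle x y) : x ≤ z.re ∧ z.re ≤ y := by
  have h := hz.2
  constructor <;> by_contra! h' <;> nlinarith [sq_nonneg z.im]

theorem neg_le_im_of_mem_lowerSemicircle {x y m : ℝ} (hxy : x < y) (hm : y - x ≤ m) {z : ℂ}
    (hz : z ∈ lowerSemicircle x y) : -m ≤ z.im := by
  obtain ⟨h1, h2⟩ := re_mem_of_mem_lowerSemicircle hxy hz
  have h := hz.2
  by_contra! h'
  nlinarith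

theorem re_eq_of_mem_lowerSemicircle {x y : ℝ} {z : ℂ}
    (hz : z ∈ lowerSemicircle x y) (h0 : z.im = 0) : z.re = x ∨ z.re = y := by
  have h := hz.2
  rw [h0] at h
  rcases mul_eq_zero.1 (show (z.re - x) * (z.re - y) = 0 by linarith) with h | h
  · left; linarith
  · right; linarith

theorem joinedIn_lowerSemicircle {x y : ℝ} (hxy : x < y) :
    JoinedIn (lowerSemicircle x y) x y := by
  refine JoinedIn.ofLine
    (f := fun t : ℝ => (⟨x + t * (y - x), -(Real.sqrt (t * (1 - t)) * (y - x))⟩ : ℂ)) ?_ ?_ ?_ ?_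
  · have : (fun t : ℝ => (⟨x + t * (y - x), -(Real.sqrt (t * (1 - t)) * (y - x))⟩ : ℂ)) =
        fun t : ℝ => ((x + t * (y - x) : ℝ) : ℂ) +
          ((-(Real.sqrt (t * (1 - t)) * (y - x)) : ℝ) : ℂ) * Complex.I := by
      funext t; apply Complex.ext <;> simp
    rw [this]
    fun_prop
  · apply Complex.ext <;> simp
  · apply Complex.ext <;> simp
  · rintro _ ⟨t, ⟨h0, h1⟩, rfl⟩
    have hs := Real.sq_sqrt (mul_nonneg h0 (sub_nonneg.2 h1))
    refine ⟨?_, ?_⟩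
    · have := mul_nonneg (Real.sqrt_nonneg (t * (1 - t))) (sub_nonneg.2 hxy.le)
      simpa using this
    · simp only
      linear_combination (y - x) ^ 2 * hs

/-- At a common point both products `(re - x) * (y - re)` and `(re - x') * (y' - re)` equal `im ^
2`, but over `[x', y']` both factors of the first are strictly larger. -/
theorem disjoint_lowerSemicircle_of_nested {x y x' y' : ℝ} (h : x < x') (h' : x' < y')
    (h'' : y' < y) : Disjoint (lowerSemicircle x y) (lowerSemicircle x' y') := by
  rw [Set.disjoint_left]
  intro z hz hz'
  obtain ⟨h1, h2⟩ := re_mem_of_mem_lowerSemicircle h' hz'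
  have e1 := hz.2
  have e2 := hz'.2
  nlinarith

theorem disjoint_lowerSemicircle_of_lt {x y x' y' : ℝ} (h : x < y) (h' : y < x')
    (h'' : x' < y') : Disjoint (lowerSemicircle x y) (lowerSemicircle x' y') := by
  rw [Set.disjoint_left]
  intro z hz hz'
  have h1 := re_mem_of_mem_lowerSemicircle h hz
  have h2 := re_mem_of_mem_lowerSemicircle h'' hz'
  linarith

theorem JoinedIn.exists_eq_of_interleaved {K L : Set ℂ} {m a b c d : ℝ} (hab : a < b) (hbc : b < c)
    (hcd : c < d) (hK : JoinedIn K ⟨a, m⟩ ⟨c, m⟩) (hL : JoinedIn L ⟨b, m⟩ ⟨d, m⟩)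
    (hKm : ∀ z ∈ K, m ≤ z.im) (hLm : ∀ z ∈ L, m ≤ z.im) : ¬ Disjoint K L := by
  intro hdis
  obtain ⟨α, hα⟩ := hK
  obtain ⟨β, hβ⟩ := hL
  obtain ⟨s, t, hst⟩ := _root_.exists_eq_of_interleaved hab hbc hcd α β
    (fun s => hKm _ (hα s)) (fun s => hLm _ (hβ s))
  exact Set.disjoint_left.1 hdis (hα s) (hst ▸ hβ t)

/-- A drawing whose image under `g` lies in the closed upper half plane and meets the real line in
the vertices `w k`, `k ∈ [m, n]`, from left to right. -/
structure HalfPlaneDrawing {W D : Type*} [TopologicalSpace D] {H : SimpleGraph W}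
    (δ : GraphDrawing H D) (g : D → ℂ) (m n : ℕ) (w : ℕ → W) (ξ : ℕ → ℝ) : Prop where
  continuousOn : ContinuousOn g (δ.trace Set.univ)
  injOn : Set.InjOn g (δ.trace Set.univ)
  im_nonneg : ∀ q ∈ δ.trace Set.univ, 0 ≤ (g q).im
  boundary : ∀ q ∈ δ.trace Set.univ, (g q).im = 0 → ∃ k ∈ Set.Icc m n, q = δ.pos (w k)
  strictMonoOn : StrictMonoOn ξ (Set.Icc m n)
  pos_eq : ∀ k ∈ Set.Icc m n, g (δ.pos (w k)) = ξ k

namespace HalfPlaneDrawing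

variable {W D : Type*} [TopologicalSpace D] {H : SimpleGraph W}
    {δ : GraphDrawing H D} {g : D → ℂ} {m n : ℕ} {w : ℕ → W} {ξ : ℕ → ℝ}

/-- The points drawn for the induced subgraph on `X`, with the edges of `C` between boundary
vertices in `X` drawn as semicircles, and with vertical segments below `w a` and `w c`. -/
def extendedTrace (δ : GraphDrawing H D) (g : D → ℂ) (m n : ℕ) (w : ℕ → W) (ξ : ℕ → ℝ)
    (X : Set W) (C : SimpleGraph W) (a c : ℕ) : Set ℂ :=
  g '' δ.trace X ∪ {z | ∃ i j, i ∈ Set.Icc m n ∧ j ∈ Set.Icc m n ∧ i < j ∧ w i ∈ X ∧ w j ∈ X ∧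
    C.Adj (w i) (w j) ∧ z ∈ lowerSemicircle (ξ i) (ξ j)} ∪
    {z | z.im ≤ 0 ∧ -(ξ n - ξ m) ≤ z.im ∧ (z.re = ξ a ∨ z.re = ξ c)}

theorem injOn_index (h : HalfPlaneDrawing δ g m n w ξ) : Set.InjOn w (Set.Icc m n) := by
  intro i hi j hj e
  have := h.pos_eq i hi
  rw [e, h.pos_eq j hj] at this
  exact (h.strictMonoOn.injOn hi hj (by exact_mod_cast this.symm))

theorem sub_le_sub (h : HalfPlaneDrawing δ g m n w ξ) {i j : ℕ} (hi : i ∈ Set.Icc m n)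
    (hj : j ∈ Set.Icc m n) : ξ j - ξ i ≤ ξ n - ξ m := by
  have hmn : m ≤ n := hi.1.trans hi.2
  have h1 := h.strictMonoOn.monotoneOn hj ⟨hmn, le_rfl⟩ hj.2
  have h2 := h.strictMonoOn.monotoneOn ⟨le_rfl, hmn⟩ hi hi.1
  linarith

theorem neg_le_im (h : HalfPlaneDrawing δ g m n w ξ) {X : Set W} {C : SimpleGraph W} {a c : ℕ}
    (ha : a ∈ Set.Icc m n) :
    ∀ z ∈ extendedTrace δ g m n w ξ X C a c, -(ξ n - ξ m) ≤ z.im := by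
  have h0 := h.sub_le_sub ha ha
  rintro _ ((⟨q, hq, rfl⟩ | ⟨i, j, hi, hj, hij, -, -, -, hz⟩) | hz)
  · have := h.im_nonneg q (δ.trace_mono (Set.subset_univ _) hq)
    linarith
  · exact neg_le_im_of_mem_lowerSemicircle (h.strictMonoOn hi hj hij) (h.sub_le_sub hi hj) hz
  · exact hz.2.1

/-- The crossing lemma needs its four ends on the line bounding the half plane, while the
semicircles dip below the real line. The segments carry the ends down to a level that no semicircle
passes. -/
theorem joinedIn_segment (h : HalfPlaneDrawing δ g m n w ξ) {X : Set W} {C : SimpleGraph W}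
    {a c e : ℕ} (he : e = a ∨ e = c) (heI : e ∈ Set.Icc m n) :
    JoinedIn (extendedTrace δ g m n w ξ X C a c) ⟨ξ e, -(ξ n - ξ m)⟩ (ξ e) := by
  have h0 := h.sub_le_sub heI heI
  rw [sub_self] at h0
  refine JoinedIn.ofLine (f := fun t : ℝ => (⟨ξ e, -(ξ n - ξ m) * (1 - t)⟩ : ℂ)) ?_ ?_ ?_ ?_
  · have : (fun t : ℝ => (⟨ξ e, -(ξ n - ξ m) * (1 - t)⟩ : ℂ)) =
        fun t : ℝ => (ξ e : ℂ) + ((-(ξ n - ξ m) * (1 - t) : ℝ) : ℂ) * Complex.I := by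
      funext t; apply Complex.ext <;> simp
    rw [this]
    fun_prop
  · simp
  · apply Complex.ext <;> simp
  · rintro _ ⟨t, ⟨ht0, ht1⟩, rfl⟩
    refine .inr ⟨?_, ?_, ?_⟩
    · simp only; nlinarith
    · simp only; nlinarith
    · rcases he with rfl | rfl
      · exact .inl rfl
      · exact .inr rfl

theorem joinedIn_extendedTrace (h : HalfPlaneDrawing δ g m n w ξ) {X : Set W} {C : SimpleGraph W}
    {a c : ℕ} (ha : a ∈ Set.Icc m n) (hc : c ∈ Set.Icc m n)
    (hC : ∀ x y, C.Adj x y → ∃ i ∈ Set.Icc m n, x = w i)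
    (hX : (H ⊔ C).JoinedWithin X (w a) (w c)) :
    JoinedIn (extendedTrace δ g m n w ξ X C a c) ⟨ξ a, -(ξ n - ξ m)⟩ ⟨ξ c, -(ξ n - ξ m)⟩ := by
  refine (h.joinedIn_segment (.inl rfl) ha).trans (JoinedIn.trans ?_
    (h.joinedIn_segment (.inr rfl) hc).symm)
  rw [← h.pos_eq a ha, ← h.pos_eq c hc]
  refine hX.rec_rel
    (R := fun x y => JoinedIn (extendedTrace δ g m n w ξ X C a c) (g (δ.pos x)) (g (δ.pos y)))
    (fun x hx => JoinedIn.refl (.inl (.inl ⟨_, δ.pos_mem_trace hx, rfl⟩))) ?_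
  intro x y z hx hy hxy hyz
  refine JoinedIn.trans ?_ hyz
  rcases hxy with hxy | hxy
  · exact ((δ.joinedIn_trace_of_adj hxy hx hy).map_continuousOn
      (h.continuousOn.mono (δ.trace_mono (Set.subset_univ _)))).mono fun z hz => .inl (.inl hz)
  · have key : ∀ i j, i ∈ Set.Icc m n → j ∈ Set.Icc m n → i < j → w i ∈ X → w j ∈ X →
        C.Adj (w i) (w j) → JoinedIn (extendedTrace δ g m n w ξ X C a c) (g (δ.pos (w i)))
          (g (δ.pos (w j))) := by
      intro i j hi hj hij hiX hjX hadj
      rw [h.pos_eq i hi, h.pos_eq j hj]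
      exact (joinedIn_lowerSemicircle (h.strictMonoOn hi hj hij)).mono fun z hz =>
        .inl (.inr ⟨i, j, hi, hj, hij, hiX, hjX, hadj, hz⟩)
    obtain ⟨i, hi, rfl⟩ := hC _ _ hxy
    obtain ⟨j, hj, rfl⟩ := hC _ _ hxy.symm
    rcases lt_trichotomy i j with hij | rfl | hij
    · exact key i j hi hj hij hx hy hxy
    · exact (hxy.ne rfl).elim
    · exact (key j i hj hi hij hy hx hxy.symm).symm

theorem re_eq_of_im_eq_zero (h : HalfPlaneDrawing δ g m n w ξ) {X : Set W} {z : ℂ}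
    (hz : z ∈ g '' δ.trace X) (h0 : z.im ≤ 0) : ∃ k ∈ Set.Icc m n, w k ∈ X ∧ z = ξ k := by
  obtain ⟨q, hq, rfl⟩ := hz
  have hq' := δ.trace_mono (Set.subset_univ _) hq
  obtain ⟨k, hk, rfl⟩ := h.boundary q hq' (le_antisymm h0 (h.im_nonneg q hq'))
  exact ⟨k, hk, δ.mem_of_pos_mem_trace hq, h.pos_eq k hk⟩

theorem index_eq (h : HalfPlaneDrawing δ g m n w ξ) {i j : ℕ} (hi : i ∈ Set.Icc m n)
    (hj : j ∈ Set.Icc m n) (e : ξ i = ξ j) : i = j := h.strictMonoOn.injOn hi hj e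

/-- The vertex sets `X` and `Y` cannot be disjoint if they join interleaved pairs of boundary
vertices, even with the help of two noninterleaved families of additional edges between boundary
vertices further to the right. -/
theorem false_of_interleaved (h : HalfPlaneDrawing δ g m n w ξ) {X Y : Set W}
    {C C' : SimpleGraph W} {a b c d : ℕ} (hma : m ≤ a) (hab : a < b) (hbc : b < c) (hcd : c < d)
    (hdn : d ≤ n) (hXY : Disjoint X Y)
    (hC : ∀ x y, C.Adj x y → ∃ i, d < i ∧ i ≤ n ∧ x = w i)
    (hC' : ∀ x y, C'.Adj x y → ∃ i, d < i ∧ i ≤ n ∧ x = w i)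
    (hCC : ∀ i j k l, d < i → i < j → j < k → k < l → l ≤ n →
      C.Adj (w i) (w k) → C'.Adj (w j) (w l) → False)
    (hCC' : ∀ i j k l, d < i → i < j → j < k → k < l → l ≤ n →
      C'.Adj (w i) (w k) → C.Adj (w j) (w l) → False)
    (hX : (H ⊔ C).JoinedWithin X (w a) (w c)) (hY : (H ⊔ C').JoinedWithin Y (w b) (w d)) :
    False := by
  have ha : a ∈ Set.Icc m n := ⟨by omega, by omega⟩
  have hb : b ∈ Set.Icc m n := ⟨by omega, by omega⟩
  have hc : c ∈ Set.Icc m n := ⟨by omega, by omega⟩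
  have hd : d ∈ Set.Icc m n := ⟨by omega, by omega⟩
  have lt : ∀ {i j : ℕ}, i ∈ Set.Icc m n → j ∈ Set.Icc m n → i < j → ξ i < ξ j :=
    fun hi hj hij => h.strictMonoOn hi hj hij
  have far : ∀ {C : SimpleGraph W}, (∀ x y, C.Adj x y → ∃ i, d < i ∧ i ≤ n ∧ x = w i) →
      ∀ i ∈ Set.Icc m n, ∀ y, C.Adj (w i) y → d < i := by
    intro C hC i hi y hy
    obtain ⟨j, hj, hjn, e⟩ := hC _ _ hy
    rwa [h.injOn_index hi ⟨by omega, hjn⟩ e]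
  have trace_arc : ∀ {X Y : Set W} {z : ℂ} {i j : ℕ}, Disjoint X Y → z ∈ g '' δ.trace X →
      i ∈ Set.Icc m n → j ∈ Set.Icc m n → w i ∈ Y → w j ∈ Y →
      z ∈ lowerSemicircle (ξ i) (ξ j) → False := by
    intro X Y z i j hXY hz hi hj hiY hjY hzs
    obtain ⟨k, hk, hkX, rfl⟩ := h.re_eq_of_im_eq_zero hz hzs.1
    rcases re_eq_of_mem_lowerSemicircle hzs (Complex.ofReal_im _) with e | e <;>
      rw [Complex.ofReal_re] at e
    · exact Set.disjoint_left.1 hXY hkX (h.index_eq hk hi e ▸ hiY)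
    · exact Set.disjoint_left.1 hXY hkX (h.index_eq hk hj e ▸ hjY)
  have trace_segment : ∀ {X Y : Set W} {z : ℂ} {i : ℕ}, Disjoint X Y → z ∈ g '' δ.trace X →
      i ∈ Set.Icc m n → w i ∈ Y → z.im ≤ 0 → z.re = ξ i → False := by
    intro X Y z i hXY hz hi hiY him hre
    obtain ⟨k, hk, hkX, rfl⟩ := h.re_eq_of_im_eq_zero hz him
    exact Set.disjoint_left.1 hXY hkX (h.index_eq hk hi hre ▸ hiY)
  have arc_segment : ∀ {C : SimpleGraph W}, (∀ x y, C.Adj x y → ∃ i, d < i ∧ i ≤ n ∧ x = w i) →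
      ∀ {z : ℂ} {i j k : ℕ}, i ∈ Set.Icc m n → j ∈ Set.Icc m n → k ∈ Set.Icc m n → i < j → k ≤ d →
      C.Adj (w i) (w j) → z ∈ lowerSemicircle (ξ i) (ξ j) → z.re = ξ k → False := by
    intro C hC z i j k hi hj hk hij hkd hadj hz hre
    have h1 := (re_mem_of_mem_lowerSemicircle (lt hi hj hij) hz).1
    have h2 := lt hk hi (hkd.trans_lt (far hC i hi _ hadj))
    linarith
  refine JoinedIn.exists_eq_of_interleaved (lt ha hb hab) (lt hb hc hbc) (lt hc hd hcd)
    (h.joinedIn_extendedTrace ha hc (fun x y hxy => ?_) hX)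
    (h.joinedIn_extendedTrace hb hd (fun x y hxy => ?_) hY) (h.neg_le_im ha) (h.neg_le_im hb) ?_
  · obtain ⟨i, h1, h2, h3⟩ := hC x y hxy
    exact ⟨i, ⟨by omega, h2⟩, h3⟩
  · obtain ⟨i, h1, h2, h3⟩ := hC' x y hxy
    exact ⟨i, ⟨by omega, h2⟩, h3⟩
  have hwX := And.intro hX.left_mem hX.right_mem
  have hwY := And.intro hY.left_mem hY.right_mem
  rw [Set.disjoint_left]
  rintro z ((hz | ⟨i, k, hi, hk, hik, hiX, hkX, hadj, hz⟩) | ⟨him, -, hre⟩)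
    ((hz' | ⟨j, l, hj, hl, hjl, hjY, hlY, hadj', hz'⟩) | ⟨him', -, hre'⟩)
  · obtain ⟨q, hq, rfl⟩ := hz
    obtain ⟨q', hq', e⟩ := hz'
    have := h.injOn (δ.trace_mono (Set.subset_univ _) hq') (δ.trace_mono (Set.subset_univ _) hq) e
    exact Set.disjoint_left.1 (δ.disjoint_trace hXY) hq (this ▸ hq')
  · exact trace_arc hXY hz hj hl hjY hlY hz'
  · rcases hre' with hre' | hre'
    · exact trace_segment hXY hz hb hwY.1 him' hre'
    · exact trace_segment hXY hz hd hwY.2 him' hre'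
  · exact trace_arc hXY.symm hz' hi hk hiX hkX hz
  · have hdi := far hC i hi _ hadj
    have hdj := far hC' j hj _ hadj'
    have hij : i ≠ j := fun e => Set.disjoint_left.1 hXY hiX (e ▸ hjY)
    have hil : i ≠ l := fun e => Set.disjoint_left.1 hXY hiX (e ▸ hlY)
    have hkj : k ≠ j := fun e => Set.disjoint_left.1 hXY hkX (e ▸ hjY)
    have hkl : k ≠ l := fun e => Set.disjoint_left.1 hXY hkX (e ▸ hlY)
    -- The four ends are distinct. Nested semicircles and semicircles side by side are disjoint; the
    -- two interleaved orders are excluded by `hCC` and `hCC'`.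
    rcases lt_or_gt_of_ne hij with hij | hij
    · rcases lt_or_gt_of_ne hkj with hkj | hkj
      · exact Set.disjoint_left.1 (disjoint_lowerSemicircle_of_lt (lt hi hk hik) (lt hk hj hkj)
          (lt hj hl hjl)) hz hz'
      · rcases lt_or_gt_of_ne hkl with hkl | hkl
        · exact hCC i j k l hdi hij hkj hkl hl.2 hadj hadj'
        · exact Set.disjoint_left.1 (disjoint_lowerSemicircle_of_nested (lt hi hj hij)
            (lt hj hl hjl) (lt hl hk hkl)) hz hz'
    · rcases lt_or_gt_of_ne hil with hil | hil
      · rcases lt_or_gt_of_ne hkl with hkl | hkl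
        · exact Set.disjoint_left.1 (disjoint_lowerSemicircle_of_nested (lt hj hi hij)
            (lt hi hk hik) (lt hk hl hkl)) hz' hz
        · exact hCC' j i l k hdj hij hil hkl hk.2 hadj' hadj
      · exact Set.disjoint_left.1 (disjoint_lowerSemicircle_of_lt (lt hj hl hjl) (lt hl hi hil)
          (lt hi hk hik)) hz' hz
  · rcases hre' with hre' | hre'
    · exact arc_segment hC hi hk hb hik (by omega) hadj hz hre'
    · exact arc_segment hC hi hk hd hik le_rfl hadj hz hre'
  · rcases hre with hre | hre
    · exact trace_segment hXY.symm hz' ha hwX.1 him hre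
    · exact trace_segment hXY.symm hz' hc hwX.2 him hre
  · rcases hre with hre | hre
    · exact arc_segment hC' hj hl ha hjl (by omega) hadj' hz' hre
    · exact arc_segment hC' hj hl hc hjl (by omega) hadj' hz' hre
  · have := lt ha hb hab
    have := lt hb hc hbc
    have := lt hc hd hcd
    rcases hre with hre | hre <;> rcases hre' with hre' | hre' <;> linarith

end HalfPlaneDrawing

/-! ### From the disc to the half plane -/

/-- The Möbius transformation that maps the unit disc to the upper half plane, with pole `ζ`. -/
noncomputable def discToHalfPlane (ζ z : ℂ) : ℂ := Complex.I * (ζ + z) / (ζ - z)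

theorem discToHalfPlane_im {ζ z : ℂ} (hζ : ‖ζ‖ = 1) :
    (discToHalfPlane ζ z).im = (1 - ‖z‖ ^ 2) / Complex.normSq (ζ - z) := by
  have h1 : ζ.re * ζ.re + ζ.im * ζ.im = 1 := by
    rw [← Complex.normSq_apply, Complex.normSq_eq_norm_sq, hζ, one_pow]
  rw [discToHalfPlane, Complex.div_im, ← Complex.normSq_eq_norm_sq, Complex.normSq_apply z, ← h1]
  simp
  ring

theorem discToHalfPlane_injective {ζ z z' : ℂ} (h0 : ζ ≠ 0) (hz : z ≠ ζ) (hz' : z' ≠ ζ)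
    (h : discToHalfPlane ζ z = discToHalfPlane ζ z') : z = z' := by
  rw [discToHalfPlane, discToHalfPlane,
    div_eq_div_iff (sub_ne_zero.2 hz.symm) (sub_ne_zero.2 hz'.symm)] at h
  have : (2 * Complex.I * ζ) * (z - z') = 0 := by linear_combination h
  rcases mul_eq_zero.1 this with h | h
  · simp [h0] at h
  · exact sub_eq_zero.1 h

/-- With `u = exp (η * I)` the point is `-ζ * u ^ 2`, and `I * (1 - u ^ 2) / (1 + u ^ 2) = tan η`.
Hence increasing angles become increasing real numbers. -/
theorem discToHalfPlane_exp {θ₀ η : ℝ} (hη : Real.cos η ≠ 0) :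
    discToHalfPlane (Complex.exp (θ₀ * Complex.I))
      (Complex.exp ((θ₀ + Real.pi + 2 * η : ℝ) * Complex.I)) = (Real.tan η : ℂ) := by
  set ζ := Complex.exp (θ₀ * Complex.I)
  have hζ : ζ ≠ 0 := Complex.exp_ne_zero _
  set u := Complex.exp (η * Complex.I) with hu
  have hu0 : u ≠ 0 := Complex.exp_ne_zero _
  have e : Complex.exp ((θ₀ + Real.pi + 2 * η : ℝ) * Complex.I) = -(ζ * u ^ 2) := by
    have : ((θ₀ + Real.pi + 2 * η : ℝ) * Complex.I : ℂ) =
        θ₀ * Complex.I + Real.pi * Complex.I + (η * Complex.I + η * Complex.I) := by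
      push_cast; ring
    rw [this, Complex.exp_add, Complex.exp_add, Complex.exp_add, Complex.exp_pi_mul_I]
    ring
  have huv : u = Complex.cos η + Complex.sin η * Complex.I := by rw [hu, Complex.exp_mul_I]
  have hcs : Complex.cos η ^ 2 + Complex.sin η ^ 2 = 1 := Complex.cos_sq_add_sin_sq _
  have hc : Complex.cos η ≠ 0 := by exact_mod_cast hη
  have e1 : 1 - u ^ 2 = -2 * Complex.I * Complex.sin η * u := by
    rw [huv]
    linear_combination -hcs + Complex.sin η ^ 2 * Complex.I_sq
  have e2 : 1 + u ^ 2 = 2 * Complex.cos η * u := by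
    rw [huv]
    linear_combination -hcs + Complex.sin η ^ 2 * Complex.I_sq
  rw [discToHalfPlane, e, Complex.ofReal_tan, Complex.tan_eq_sin_div_cos,
    div_eq_div_iff ?_ hc]
  · linear_combination (Complex.I * ζ * Complex.cos η) * e1 - Complex.sin η * ζ * e2 -
      2 * ζ * Complex.cos η * Complex.sin η * u * Complex.I_sq
  · have : ζ - -(ζ * u ^ 2) = ζ * (2 * Complex.cos η * u) := by linear_combination ζ * e2
    rw [this]
    exact mul_ne_zero hζ (mul_ne_zero (mul_ne_zero two_ne_zero hc) hu0)

/-- Cutting the boundary of the disc between `v 1` and `v 2` yields a drawing in a half plane. -/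
theorem GraphDrawing.BoundaryInOrder.exists_halfPlaneDrawing {W D : Type*} [TopologicalSpace D]
    {H : SimpleGraph W} {δ : GraphDrawing H D} {φ : UnitDisc ≃ₜ D} {T : ℕ} {v : ℕ → W}
    (hv : δ.BoundaryInOrder φ T v) (hint : δ.EdgesInInterior φ) (hT : 2 ≤ T) :
    ∃ g ξ, HalfPlaneDrawing δ g 2 (T + 1) (fun k => if k = T + 1 then v 1 else v k) ξ := by
  obtain ⟨⟨θ, hθ, hθT, hθv⟩, hbd⟩ := hv
  have h12 : θ 1 < θ 2 := hθ ⟨le_rfl, by omega⟩ ⟨by omega, hT⟩ (by omega)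
  -- The pole sits in the middle of the gap between `v 1` and `v 2`. Counted from there, `v 2` comes
  -- first and `v 1` last, one turn later, under the index `T + 1`.
  set θ₀ := (θ 1 + θ 2) / 2 with hθ₀
  set ζ := Complex.exp (θ₀ * Complex.I) with hζdef
  have hζ0 : ζ ≠ 0 := Complex.exp_ne_zero _
  have hζ1 : ‖ζ‖ = 1 := Complex.norm_exp_ofReal_mul_I _
  let θ' : ℕ → ℝ := fun k => if k = T + 1 then θ 1 + 2 * Real.pi else θ k
  let η : ℕ → ℝ := fun k => (θ' k - θ₀ - Real.pi) / 2
  have hmono : StrictMonoOn θ' (Set.Icc 2 (T + 1)) := by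
    intro i hi j hj hij
    have hi' : i ≠ T + 1 := by have := hj.2; omega
    simp only [θ', if_neg hi']
    split_ifs with hj'
    · exact (hθ.monotoneOn ⟨by have := hi.1; omega, by have := hi.2; omega⟩ ⟨by omega, le_rfl⟩
        (by have := hi.2; omega)).trans_lt hθT
    · exact hθ ⟨by have := hi.1; omega, by have := hi.2; omega⟩
        ⟨by have := hj.1; omega, by have := hj.2; omega⟩ hij
  have hη : ∀ k ∈ Set.Icc 2 (T + 1), η k ∈ Set.Ioo (-(Real.pi / 2)) (Real.pi / 2) := by
    intro k hk
    have h1 := hmono.monotoneOn ⟨le_rfl, by omega⟩ hk hk.1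
    have h2 := hmono.monotoneOn hk ⟨by omega, le_rfl⟩ hk.2
    simp only [θ', if_true, if_neg (show (2 : ℕ) ≠ T + 1 by omega)] at h1 h2
    simp only [η, θ']
    constructor <;> linarith
  have hexp : ∀ k ∈ Set.Icc 2 (T + 1),
      (φ.symm (δ.pos (if k = T + 1 then v 1 else v k)) : ℂ) =
        Complex.exp ((θ₀ + Real.pi + 2 * η k : ℝ) * Complex.I) := by
    intro k hk
    have : θ₀ + Real.pi + 2 * η k = θ' k := by simp only [η]; ring
    rw [this]
    simp only [θ']
    split_ifs with h
    · rw [hθv 1 ⟨le_rfl, by omega⟩]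
      push_cast
      rw [add_mul, Complex.exp_add, Complex.exp_two_pi_mul_I, mul_one]
    · exact hθv k ⟨by have := hk.1; omega, by have := hk.2; omega⟩
  have htrace : ∀ q ∈ δ.trace Set.univ, ‖(φ.symm q : ℂ)‖ = 1 →
      ∃ k ∈ Set.Icc 2 (T + 1), q = δ.pos (if k = T + 1 then v 1 else v k) := by
    rintro q (⟨u, -, rfl⟩ | ⟨u, w, h, -, -, s, hs, rfl⟩) hq
    · obtain ⟨i, hi, rfl⟩ := hbd u hq
      by_cases h1 : i = 1
      · exact ⟨T + 1, ⟨by omega, le_rfl⟩, by rw [if_pos rfl, h1]⟩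
      · exact ⟨i, ⟨by have := hi.1; omega, by have := hi.2; omega⟩,
          by rw [if_neg (by have := hi.2; omega)]⟩
    · exact ((hint u w h s hs).ne hq).elim
  have hcos : ∀ k ∈ Set.Icc 2 (T + 1), Real.cos (η k) ≠ 0 := fun k hk =>
    (Real.cos_pos_of_mem_Ioo (hη k hk)).ne'
  have hne : ∀ q ∈ δ.trace Set.univ, (φ.symm q : ℂ) ≠ ζ := by
    intro q hq e
    obtain ⟨k, hk, rfl⟩ := htrace q hq (by rw [e, hζ1])
    rw [hexp k hk] at e
    have hk' := hη k hk
    rw [hζdef, Complex.exp_eq_exp_iff_exists_int] at e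
    obtain ⟨n, hn⟩ := e
    have h2 : (Real.pi + 2 * η k : ℝ) = n * (2 * Real.pi) := by
      have : ((Real.pi + 2 * η k : ℝ) : ℂ) = ((n * (2 * Real.pi) : ℝ) : ℂ) := by
        apply mul_right_cancel₀ Complex.I_ne_zero
        push_cast at hn ⊢
        linear_combination hn
      exact_mod_cast this
    -- `π + 2 * η k` lies strictly between `0` and `2 * π`, so no boundary vertex is at the pole.
    have hpi := Real.pi_pos
    have h3 : (0 : ℝ) < n := by
      by_contra! h
      nlinarith [hk'.1]
    have h4 : (n : ℝ) < 1 := by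
      by_contra! h
      nlinarith [hk'.2]
    have h3' : 0 < n := by exact_mod_cast h3
    have h4' : n < 1 := by exact_mod_cast h4
    omega
  have hnorm : ∀ q, ‖(φ.symm q : ℂ)‖ ≤ 1 := fun q =>
    mem_closedBall_zero_iff.1 (φ.symm q).2
  refine ⟨fun q => discToHalfPlane ζ (φ.symm q), fun k => Real.tan (η k), ?_, ?_, ?_, ?_, ?_, ?_⟩
  · have hc : Continuous fun q => (φ.symm q : ℂ) := by fun_prop
    exact ContinuousOn.div (by fun_prop) (by fun_prop) fun q hq => sub_ne_zero.2 (hne q hq).symm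
  · intro q hq q' hq' e
    exact φ.symm.injective (Subtype.ext
      (discToHalfPlane_injective hζ0 (hne q hq) (hne q' hq') e))
  · intro q _
    rw [discToHalfPlane_im hζ1]
    exact div_nonneg (by nlinarith [hnorm q, norm_nonneg (φ.symm q : ℂ)]) (Complex.normSq_nonneg _)
  · intro q hq h0
    rw [discToHalfPlane_im hζ1] at h0
    apply htrace q hq
    rcases div_eq_zero_iff.1 h0 with h | h
    · nlinarith [hnorm q, norm_nonneg (φ.symm q : ℂ)]
    · exact (hne q hq (sub_eq_zero.1 (Complex.normSq_eq_zero.1 h)).symm).elim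
  · intro i hi j hj hij
    refine Real.strictMonoOn_tan (hη i hi) (hη j hj) ?_
    have := hmono hi hj hij
    simp only [η]; linarith
  · intro k hk
    rw [hexp k hk, hζdef, discToHalfPlane_exp (hcos k hk)]

/-! ### Connected vertex sets and cross-freeness -/

namespace SimpleGraph

variable {V : Type*} {H H' : SimpleGraph V} {X Y : Set V} {u v w : V}

/-- Any two vertices of `X` are joined by a walk within `X`. -/
def ConnOn (H : SimpleGraph V) (X : Set V) : Prop := ∀ u ∈ X, ∀ v ∈ X, H.JoinedWithin X u v

theorem ConnOn.mono_graph (h : H.ConnOn X) (hH : H ≤ H') : H'.ConnOn X :=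
  fun u hu v hv => (h u hu v hv).mono_graph hH

theorem ConnOn.joined (h : H.ConnOn X) (hXY : X ⊆ Y) (hu : u ∈ X) (hv : v ∈ X) :
    H.JoinedWithin Y u v := (h u hu v hv).mono hXY

theorem ConnOn.union (hX : H.ConnOn X) (hY : H.ConnOn Y) (hu : u ∈ X) (hu' : u ∈ Y) :
    H.ConnOn (X ∪ Y) := by
  have key : ∀ x ∈ X ∪ Y, H.JoinedWithin (X ∪ Y) x u := by
    rintro x (hx | hx)
    · exact hX.joined Set.subset_union_left hx hu
    · exact hY.joined Set.subset_union_right hx hu'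
  exact fun x hx y hy => (key x hx).trans (key y hy).symm

theorem connOn_singleton : H.ConnOn {u} := by
  rintro x rfl y rfl
  exact .refl rfl

theorem ConnOn.insert_of_adj (hX : H.ConnOn X) (hu : u ∈ X) (h : H.Adj v u) :
    H.ConnOn (insert v X) := by
  have key : ∀ x ∈ insert v X, H.JoinedWithin (insert v X) x u := by
    rintro x (rfl | hx)
    · exact .of_adj h (Set.mem_insert _ _) (Set.mem_insert_of_mem _ hu)
    · exact hX.joined (Set.subset_insert _ _) hx hu
  exact fun x hx y hy => (key x hx).trans (key y hy).symm

theorem connOn_image_Icc {f : ℕ → V} {i j : ℕ}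
    (h : ∀ k, i ≤ k → k < j → H.Adj (f k) (f (k + 1))) : H.ConnOn (f '' Set.Icc i j) := by
  have key : ∀ k, i ≤ k → k ≤ j → H.JoinedWithin (f '' Set.Icc i j) (f i) (f k) := by
    intro k hik
    induction k, hik using Nat.le_induction with
    | base => exact fun hij => .refl ⟨i, ⟨le_rfl, hij⟩, rfl⟩
    | succ k hik ih =>
      intro hkj
      exact (ih (by omega)).trans (.of_adj (h k hik (by omega)) ⟨k, ⟨hik, by omega⟩, rfl⟩
        ⟨k + 1, ⟨by omega, hkj⟩, rfl⟩)
  rintro _ ⟨x, hx, rfl⟩ _ ⟨y, hy, rfl⟩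
  exact (key x hx.1 hx.2).symm.trans (key y hy.1 hy.2)

/-- No two disjoint vertex sets join interleaved pairs of the vertices `w m, …, w n`, even with the
help of two noninterleaved families of additional edges between such vertices further along. -/
def IsCrossFree (H : SimpleGraph V) (m n : ℕ) (w : ℕ → V) : Prop :=
  ∀ (X Y : Set V) (C C' : SimpleGraph V) (a b c d : ℕ), m ≤ a → a < b → b < c → c < d → d ≤ n →
    Disjoint X Y →
    (∀ x y, C.Adj x y → ∃ i, d < i ∧ i ≤ n ∧ x = w i) →
    (∀ x y, C'.Adj x y → ∃ i, d < i ∧ i ≤ n ∧ x = w i) →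
    (∀ i j k l, d < i → i < j → j < k → k < l → l ≤ n →
      C.Adj (w i) (w k) → C'.Adj (w j) (w l) → False) →
    (∀ i j k l, d < i → i < j → j < k → k < l → l ≤ n →
      C'.Adj (w i) (w k) → C.Adj (w j) (w l) → False) →
    (H ⊔ C).JoinedWithin X (w a) (w c) → (H ⊔ C').JoinedWithin Y (w b) (w d) → False

theorem IsCrossFree.false_of_connOn {m n : ℕ} {w : ℕ → V} (h : H.IsCrossFree m n w) {a b c d : ℕ}
    (hma : m ≤ a) (hab : a < b) (hbc : b < c) (hcd : c < d) (hdn : d ≤ n) (hX : H.ConnOn X)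
    (hY : H.ConnOn Y) (ha : w a ∈ X) (hc : w c ∈ X) (hb : w b ∈ Y) (hd : w d ∈ Y)
    (hXY : Disjoint X Y) : False :=
  h X Y ⊥ ⊥ a b c d hma hab hbc hcd hdn hXY (by simp) (by simp) (by simp) (by simp)
    ((hX _ ha _ hc).mono_graph (by simp)) ((hY _ hb _ hd).mono_graph (by simp))

/-- The drawing lives on the subtype `B.verts`, the combinatorics on `V`. A walk that starts in `B`
cannot leave it, as the ends of all edges of `C` lie in `B`. -/
theorem JoinedWithin.coe_of_spanningCoe {G : SimpleGraph V} {B : G.Subgraph} {C : SimpleGraph V}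
    (hC : ∀ x y, C.Adj x y → x ∈ B.verts) (h : (B.spanningCoe ⊔ C).JoinedWithin X u v)
    (hu : u ∈ B.verts) (hv : v ∈ B.verts) :
    (B.coe ⊔ C.comap Subtype.val).JoinedWithin (Subtype.val ⁻¹' X) (⟨u, hu⟩ : B.verts)
      ⟨v, hv⟩ := by
  revert hu hv
  refine h.rec_rel (R := fun u v => ∀ (hu : u ∈ B.verts) (hv : v ∈ B.verts),
    (B.coe ⊔ C.comap Subtype.val).JoinedWithin (Subtype.val ⁻¹' X) (⟨u, hu⟩ : B.verts) ⟨v, hv⟩)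
    (fun x hx _ _ => .refl hx) ?_
  intro x y z hx hy hxy ih hxB hzB
  have hyB : y ∈ B.verts := hxy.elim (fun h => h.snd_mem) (fun h => hC _ _ h.symm)
  exact (JoinedWithin.of_adj (u := (⟨x, hxB⟩ : B.verts)) (v := ⟨y, hyB⟩)
    (by simpa using hxy) hx hy).trans (ih hyB hzB)

end SimpleGraph

theorem HalfPlaneDrawing.isCrossFree {V D : Type*} [TopologicalSpace D] {G : SimpleGraph V}
    {B : G.Subgraph} {δ : GraphDrawing B.coe D} {g : D → ℂ} {m n : ℕ} {w : ℕ → B.verts}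
    {ξ : ℕ → ℝ} (h : HalfPlaneDrawing δ g m n w ξ) :
    B.spanningCoe.IsCrossFree m n fun k => (w k : V) := by
  intro X Y C C' a b c d hma hab hbc hcd hdn hXY hC hC' hCC hCC' hX hY
  have conv : ∀ {C : SimpleGraph V}, (∀ x y, C.Adj x y → ∃ i, d < i ∧ i ≤ n ∧ x = w i) →
      ∀ x y, C.Adj x y → x ∈ B.verts := by
    intro C hC x y hxy
    obtain ⟨i, -, -, rfl⟩ := hC x y hxy
    exact (w i).2
  have conv' : ∀ {C : SimpleGraph V}, (∀ x y, C.Adj x y → ∃ i, d < i ∧ i ≤ n ∧ x = w i) →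
      ∀ x y, (C.comap Subtype.val).Adj x y → ∃ i, d < i ∧ i ≤ n ∧ x = w i := by
    intro C hC x y hxy
    obtain ⟨i, h1, h2, h3⟩ := hC x y hxy
    exact ⟨i, h1, h2, Subtype.ext h3⟩
  exact h.false_of_interleaved hma hab hbc hcd hdn (hXY.preimage Subtype.val) (conv' hC)
    (conv' hC') hCC hCC'
    (hX.coe_of_spanningCoe (conv hC) (w a).2 (w c).2)
    (hY.coe_of_spanningCoe (conv hC') (w b).2 (w d).2)

/-! ### The combinatorial configuration: separation by `p`, legs, and visits to `Z` -/

open SimpleGraph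

/-- A graph `G` with a subgraph `H` (on `BV`) attached to the rest of `G` along `Z = w '' [t, N]`,
whose boundary `w 2, …, w N` is free of crosses, a connected set `P₁ ⊇ Z`, and two paths `p`, `g` of
`H`, from `w 2` to `w (t - 1)` and from `w 3` to `w (t - 2)`; these three are disjoint. -/
structure CrossConfig {V : Type*} (G H : SimpleGraph V) (BV Z P₁ : Set V) (w p g : ℕ → V)
    (t N m l : ℕ) : Prop where
  le : H ≤ G
  adj_of_notMem : ∀ u x, G.Adj u x → u ∈ BV → u ∉ Z → H.Adj u x
  mem_of_adj : ∀ u x, H.Adj u x → x ∈ BV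
  crossFree : H.IsCrossFree 2 N w
  injOn : Set.InjOn w (Set.Icc 2 N)
  ht : t ≤ N
  Z_eq : Z = w '' Set.Icc t N
  w_mem : ∀ k ∈ Set.Icc 2 N, w k ∈ BV
  conn₁ : G.ConnOn P₁
  Z_subset : Z ⊆ P₁
  p_adj : ∀ i < m, H.Adj (p i) (p (i + 1))
  p_injOn : Set.InjOn p (Set.Iic m)
  p_zero : p 0 = w 2
  p_last : p m = w (t - 1)
  g_adj : ∀ i < l, H.Adj (g i) (g (i + 1))
  g_zero : g 0 = w 3
  g_last : g l = w (t - 2)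
  p_notMem : ∀ i ≤ m, p i ∉ P₁
  g_notMem : ∀ i ≤ l, g i ∉ P₁
  p_ne_g : ∀ i ≤ m, ∀ j ≤ l, p i ≠ g j

namespace CrossConfig

variable {V : Type*} {G H : SimpleGraph V} {BV Z P₁ : Set V} {w p g : ℕ → V} {t N m l : ℕ}

section
variable (h : CrossConfig G H BV Z P₁ w p g t N m l)
include h

/-- Outside `Z`, every edge of `G` at a vertex of `BV` belongs to `H`. So the walk stays in `H` up
to its first vertex `s` in `D`, and `F` is that initial part. -/
theorem exists_hit {X D : Set V} {u z : V} (hZD : Z ⊆ D) (hX : G.JoinedWithin X u z) (hz : z ∈ D)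
    (hu : u ∈ BV) : ∃ s ∈ D, ∃ F ⊆ X, H.ConnOn F ∧ u ∈ F ∧ s ∈ F ∧ ∀ x ∈ F, x ∈ D → x = s := by
  revert hz hu
  refine hX.rec_rel (R := fun u z => z ∈ D → u ∈ BV → ∃ s ∈ D, ∃ F ⊆ X, H.ConnOn F ∧ u ∈ F ∧
    s ∈ F ∧ ∀ x ∈ F, x ∈ D → x = s) ?_ ?_
  · intro x hx hxD _
    exact ⟨x, hxD, {x}, by simpa using hx, connOn_singleton, rfl, rfl, by simp⟩
  · intro x y z hx hy hxy ih hz hxB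
    by_cases hxD : x ∈ D
    · exact ⟨x, hxD, {x}, by simpa using hx, connOn_singleton, rfl, rfl, by simp⟩
    · have hadj := h.adj_of_notMem x y hxy hxB fun hZ => hxD (hZD hZ)
      obtain ⟨s, hs, F, hFX, hF, hyF, hsF, hD⟩ := ih hz (h.mem_of_adj _ _ hadj)
      refine ⟨s, hs, insert x F, Set.insert_subset hx hFX, hF.insert_of_adj hyF hadj,
        Set.mem_insert _ _, Set.mem_insert_of_mem _ hsF, ?_⟩
      rintro y (rfl | hy') hyD
      · exact (hxD hyD).elim
      · exact hD y hy' hyD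

theorem w_notMem {e : ℕ} (he : 2 ≤ e) (het : e < t) : w e ∉ Z := by
  rw [h.Z_eq]
  rintro ⟨k, hk, e'⟩
  have := h.injOn ⟨by have := hk.1; omega, hk.2⟩ ⟨he, by have := h.ht; omega⟩ e'
  have := hk.1
  omega

theorem connOn_p {i j : ℕ} (hj : j ≤ m) : H.ConnOn (p '' Set.Icc i j) :=
  connOn_image_Icc fun k _ hk => h.p_adj k (by omega)

theorem connOn_g {i j : ℕ} (hj : j ≤ l) : H.ConnOn (g '' Set.Icc i j) :=
  connOn_image_Icc fun k _ hk => h.g_adj k (by omega)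

theorem p_notMem_Z {i : ℕ} (hi : i ≤ m) : p i ∉ Z := fun hZ => h.p_notMem i hi (h.Z_subset hZ)

theorem p_mem_BV (ht : 6 ≤ t) {i : ℕ} (hi : i ≤ m) : p i ∈ BV := by
  rcases Nat.eq_zero_or_pos i with rfl | h0
  · rw [h.p_zero]; exact h.w_mem _ ⟨le_rfl, by have := h.ht; omega⟩
  · have := h.p_adj (i - 1) (by omega)
    rw [Nat.sub_add_cancel h0] at this
    exact h.mem_of_adj _ _ this

theorem g_mem_BV (ht : 6 ≤ t) {i : ℕ} (hi : i ≤ l) : g i ∈ BV := by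
  rcases Nat.eq_zero_or_pos i with rfl | h0
  · rw [h.g_zero]; exact h.w_mem _ ⟨by omega, by have := h.ht; omega⟩
  · have := h.g_adj (i - 1) (by omega)
    rw [Nat.sub_add_cancel h0] at this
    exact h.mem_of_adj _ _ this

/-- The path `p` separates `w 3, …, w (t - 2)` from `Z` in `H`. -/
theorem false_of_avoids_p {X : Set V} {e : ℕ} {z : V} (he : 2 < e) (het : e + 1 < t)
    (hX : H.ConnOn X) (heX : w e ∈ X) (hz : z ∈ X) (hzZ : z ∈ Z)
    (hp : ∀ i ≤ m, p i ∉ X) : False := by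
  rw [h.Z_eq] at hzZ
  obtain ⟨k, hk, rfl⟩ := hzZ
  refine h.crossFree.false_of_connOn (a := 2) (b := e) (c := t - 1) (d := k) le_rfl he (by omega)
    (by have := hk.1; omega) hk.2 (h.connOn_p (i := 0) le_rfl) hX ?_ ?_ heX hz ?_
  · exact ⟨0, ⟨le_rfl, Nat.zero_le _⟩, h.p_zero⟩
  · exact ⟨m, ⟨Nat.zero_le _, le_rfl⟩, h.p_last⟩
  · rw [Set.disjoint_left]
    rintro _ ⟨i, hi, rfl⟩ hx
    exact hp i hi.2 hx

/-- Adding all of `g`, which avoids `p` and starts at `w 3`, reduces this to separation by `p`. -/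
theorem false_of_g_avoids_p (ht : 6 ≤ t) {X : Set V} {j : ℕ} {z : V} (hj : j ≤ l)
    (hX : H.ConnOn X) (hjX : g j ∈ X) (hz : z ∈ X) (hzZ : z ∈ Z)
    (hp : ∀ i ≤ m, p i ∉ X) : False := by
  refine h.false_of_avoids_p (e := 3) (X := g '' Set.Icc 0 l ∪ X) (z := z) (by omega) (by omega)
    ((h.connOn_g le_rfl).union hX ⟨j, ⟨Nat.zero_le _, hj⟩, rfl⟩ hjX)
    (.inl ⟨0, ⟨le_rfl, Nat.zero_le _⟩, h.g_zero⟩) (.inr hz) hzZ ?_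
  rintro i hi (⟨j', hj', e⟩ | hx)
  · exact h.p_ne_g i hi j' hj'.2 e.symm
  · exact hp i hi hx

theorem joined_or_mem_Z {X : Set V} {u z : V} (hX : G.JoinedWithin X u z) (hu : u ∈ BV)
    (hXZ : ∀ x ∈ X, x ∉ Z) : ∃ F ⊆ X, H.ConnOn F ∧ u ∈ F ∧ z ∈ F := by
  obtain ⟨s, hs, F, hFX, hF, huF, hsF, -⟩ := h.exists_hit (D := Z ∪ {z}) Set.subset_union_left hX
    (.inr rfl) hu
  rcases hs with hs | rfl
  · exact (hXZ s (hFX hsF) hs).elim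
  · exact ⟨F, hFX, hF, huF, hsF⟩

/-- Of two disjoint connected sets that join interleaved pairs, both meet `Z`. -/
theorem exists_mem_Z {X Y : Set V} {a b c d : ℕ} (ha : 2 ≤ a) (hab : a < b) (hbc : b < c)
    (hcd : c < d) (hdt : d < t) (hXY : Disjoint X Y) (hX : G.ConnOn X) (hY : G.ConnOn Y)
    (haX : w a ∈ X) (hcX : w c ∈ X) (hbY : w b ∈ Y) (hdY : w d ∈ Y) :
    (∃ z ∈ X, z ∈ Z) ∧ ∃ z ∈ Y, z ∈ Z := by
  have htN := h.ht
  have hw : ∀ e, 2 ≤ e → e < t → w e ∈ BV := fun e h1 h2 => h.w_mem e ⟨h1, by omega⟩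
  -- A set that meets `Z` contains a path of `H` from `w e` to some `w k` with `k ≥ t > d`. This `w
  -- k` replaces one end of the cross when only one of the two sets meets `Z`.
  have out : ∀ {X : Set V} {e : ℕ}, 2 ≤ e → e < t → G.ConnOn X → w e ∈ X → (∃ z ∈ X, z ∈ Z) →
      ∃ F ⊆ X, H.ConnOn F ∧ w e ∈ F ∧ ∃ k, t ≤ k ∧ k ≤ N ∧ w k ∈ F := by
    rintro X e he het hX heX ⟨z, hz, hzZ⟩
    obtain ⟨s, hs, F, hFX, hF, heF, hsF, -⟩ :=
      h.exists_hit subset_rfl (hX _ heX _ hz) hzZ (hw e he het)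
    rw [h.Z_eq] at hs
    obtain ⟨k, hk, rfl⟩ := hs
    exact ⟨F, hFX, hF, heF, k, hk.1, hk.2, hsF⟩
  by_cases hYZ : ∃ z ∈ Y, z ∈ Z
  · refine ⟨?_, hYZ⟩
    by_contra! hXZ
    obtain ⟨F, hFX, hF, haF, hcF⟩ := h.joined_or_mem_Z (hX _ haX _ hcX) (hw a ha (by omega)) hXZ
    obtain ⟨F', hFY, hF', hbF, k, htk, hkN, hkF⟩ := out (by omega) (by omega) hY hbY hYZ
    exact h.crossFree.false_of_connOn ha hab hbc (by omega) hkN hF hF' haF hcF hbF hkF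
      (hXY.mono hFX hFY)
  · exfalso
    push Not at hYZ
    obtain ⟨F', hFY, hF', hbF, hdF⟩ :=
      h.joined_or_mem_Z (hY _ hbY _ hdY) (hw b (by omega) (by omega)) hYZ
    by_cases hXZ : ∃ z ∈ X, z ∈ Z
    · obtain ⟨F, hFX, hF, hcF, k, htk, hkN, hkF⟩ := out (by omega) (by omega) hX hcX hXZ
      exact h.crossFree.false_of_connOn (by omega) hbc hcd (by omega) hkN hF' hF hbF hdF hcF hkF
        (hXY.mono hFX hFY).symm
    · push Not at hXZ
      obtain ⟨F, hFX, hF, haF, hcF⟩ := h.joined_or_mem_Z (hX _ haX _ hcX) (hw a ha (by omega)) hXZ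
      exact h.crossFree.false_of_connOn ha hab hbc hcd (by omega) hF hF' haF hcF hbF hdF
        (hXY.mono hFX hFY)

/-- Starting in `BV`, a path of `G` uses edges of `H` until it leaves a vertex of `Z`. -/
theorem adj_forward {q : ℕ → V} {i j : ℕ} (hq : ∀ k < j, G.Adj (q k) (q (k + 1)))
    (hi : q i ∈ BV) (hZ : ∀ k, i ≤ k → k < j → q k ∉ Z) :
    ∀ k, i ≤ k → k < j → H.Adj (q k) (q (k + 1)) := by
  have key : ∀ k, i ≤ k → k ≤ j → q k ∈ BV := by
    intro k hk
    induction k, hk using Nat.le_induction with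
    | base => exact fun _ => hi
    | succ k hk ih => exact fun hkj => h.mem_of_adj _ _ (h.adj_of_notMem _ _ (hq k (by omega))
        (ih (by omega)) (hZ k hk (by omega)))
  exact fun k hik hkj => h.adj_of_notMem _ _ (hq k hkj) (key k hik hkj.le) (hZ k hik hkj)

theorem adj_backward {q : ℕ → V} {i j : ℕ} (hq : ∀ k < j, G.Adj (q k) (q (k + 1)))
    (hj : q j ∈ BV) (hZ : ∀ k, i < k → k ≤ j → q k ∉ Z) :
    ∀ k, i ≤ k → k < j → H.Adj (q k) (q (k + 1)) := by
  have key : ∀ k ≤ j, i ≤ j - k → q (j - k) ∈ BV := by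
    intro k
    induction k with
    | zero => exact fun _ _ => hj
    | succ k ih =>
      intro hk hik
      have e : j - k = j - (k + 1) + 1 := by omega
      have hadj := hq (j - (k + 1)) (by omega)
      rw [← e] at hadj
      exact h.mem_of_adj _ _ (h.adj_of_notMem _ _ hadj.symm (ih (by omega) (by omega))
        (hZ _ (by omega) (by omega)))
  intro k hik hkj
  have := key (j - (k + 1)) (by omega) (by omega)
  rw [show j - (j - (k + 1)) = k + 1 by omega] at this
  exact (h.adj_of_notMem _ _ (hq k hkj).symm this (hZ _ (by omega) (by omega))).symm

/-- The initial part of a path, until it first meets `p`. -/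
theorem exists_leg {q : ℕ → V} {n e : ℕ} (hq : ∀ k < n, G.Adj (q k) (q (k + 1)))
    (h0 : q 0 = w e) (he : 3 ≤ e) (het : e + 2 ≤ t) (hZ : ∃ k ≤ n, q k ∈ Z) :
    ∃ α ≤ n, ∃ i ≤ m, q α = p i ∧ (∀ k < α, H.Adj (q k) (q (k + 1))) ∧
      (∀ k < α, q k ∈ BV ∧ q k ∉ P₁ ∧ ∀ i ≤ m, q k ≠ p i) ∧ ∃ j < α, ∃ k ≤ l, q j = g k := by
  classical
  have htN := h.ht
  have h0B : q 0 ∈ BV := h0 ▸ h.w_mem e ⟨by omega, by omega⟩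
  obtain ⟨hζn, hζZ⟩ := Nat.find_spec hZ
  have hζ : ∀ k < Nat.find hZ, q k ∉ Z := fun k hk hkZ => Nat.find_min hZ hk ⟨by omega, hkZ⟩
  set ζ := Nat.find hZ
  have hadj := h.adj_forward (i := 0) (j := ζ) (fun k hk => hq k (by omega)) h0B
    (fun k _ hk => hζ k hk)
  have hmem0 : ∀ k, w e ∈ q '' Set.Icc 0 k := fun k => ⟨0, ⟨le_rfl, Nat.zero_le _⟩, h0⟩
  have hP : ∃ k < ζ, ∃ i ≤ m, q k = p i := by
    by_contra! hcon
    refine h.false_of_avoids_p (e := e) (X := q '' Set.Icc 0 ζ) (z := q ζ) (by omega) (by omega)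
      (connOn_image_Icc fun k hk hk' => hadj k hk hk') (hmem0 _)
      ⟨ζ, ⟨Nat.zero_le _, le_rfl⟩, rfl⟩ hζZ ?_
    rintro i hi ⟨k, hk, e⟩
    rcases hk.2.lt_or_eq with hk | rfl
    · exact hcon k hk i hi e
    · exact h.p_notMem_Z hi (e ▸ hζZ)
  obtain ⟨hαζ, i, him, hqi⟩ := Nat.find_spec hP
  have hα : ∀ k < Nat.find hP, ∀ i ≤ m, q k ≠ p i := fun k hk i hi e =>
    Nat.find_min hP hk ⟨by omega, i, hi, e⟩
  set α := Nat.find hP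
  have hadj' : ∀ k < α, H.Adj (q k) (q (k + 1)) := fun k hk => hadj k (Nat.zero_le _) (by omega)
  have hB : ∀ k < α, q k ∈ BV := fun k hk => h.mem_of_adj _ _ (hadj' k hk).symm
  refine ⟨α, by omega, i, him, hqi, hadj', fun k hk => ⟨hB k hk, ?_, hα k hk⟩, ?_⟩
  -- If the leg met `P₁`, continuing along `P₁` inside `H` would lead to `Z` without meeting `p`.
  · intro hk1
    obtain ⟨s, hs, F, hFX, hF, hkF, hsF, -⟩ := h.exists_hit (D := Z) subset_rfl
      (h.conn₁ _ hk1 _ (h.Z_subset hζZ)) hζZ (hB k hk)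
    refine h.false_of_avoids_p (e := e) (X := q '' Set.Icc 0 k ∪ F) (z := s) (by omega) (by omega)
      ((connOn_image_Icc fun j _ hj => hadj' j (by omega)).union hF
        ⟨k, ⟨Nat.zero_le _, le_rfl⟩, rfl⟩ hkF) (.inl (hmem0 _)) (.inr hsF) hs ?_
    rintro j hj (⟨k', hk', e⟩ | hjF)
    · exact hα k' (by have := hk'.2; omega) j hj e
    · exact h.p_notMem j hj (hFX hjF)
  -- Without a common vertex with `g`, the leg and `p` would join `w 2` to `w e`, crossing `g` from
  -- `w 3` to `w (t - 2)`. The cases `e = 3` and `e = t - 2` are excluded because there the leg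
  -- starts at an end of `g`.
  · by_contra! hcon
    have hcon' : ∀ j ≤ α, ∀ k ≤ l, q j ≠ g k := by
      intro j hj k hk e
      rcases hj.lt_or_eq with hj | rfl
      · exact hcon j hj k hk e
      · exact h.p_ne_g i him k hk (hqi ▸ e)
    have he3 : e ≠ 3 := by
      rintro rfl
      exact hcon' 0 (Nat.zero_le _) 0 (Nat.zero_le _) (h0.trans h.g_zero.symm)
    have het2 : e ≠ t - 2 := by
      rintro rfl
      exact hcon' 0 (Nat.zero_le _) l le_rfl (h0.trans h.g_last.symm)
    refine h.crossFree.false_of_connOn (a := 2) (b := 3) (c := e) (d := t - 2) le_rfl (by omega)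
      (by omega) (by omega) (by omega) (X := p '' Set.Icc 0 m ∪ q '' Set.Icc 0 α)
      ((h.connOn_p le_rfl).union (connOn_image_Icc fun j _ hj => hadj' j (by omega))
        ⟨i, ⟨Nat.zero_le _, him⟩, rfl⟩ ⟨α, ⟨Nat.zero_le _, le_rfl⟩, hqi⟩)
      (h.connOn_g (i := 0) le_rfl) (.inl ⟨0, ⟨le_rfl, Nat.zero_le _⟩, h.p_zero⟩) (.inr (hmem0 _))
      ⟨0, ⟨le_rfl, Nat.zero_le _⟩, h.g_zero⟩ ⟨l, ⟨Nat.zero_le _, le_rfl⟩, h.g_last⟩ ?_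
    rw [Set.disjoint_left]
    rintro _ (⟨j, hj, rfl⟩ | ⟨j, hj, rfl⟩) ⟨k, hk, e⟩
    · exact h.p_ne_g j hj.2 k hk.2 e.symm
    · exact hcon' j hj.2 k hk.2 e.symm

end

end CrossConfig

/-! ### Excursions to `Z` as virtual edges -/

/-- Two vertices `u, u'` of `Z` on a subpath with vertex set `M ⊆ X` that avoids `S`, such that the
parts `F`, `F'` before `u` and after `u'`, which lead to the vertices `z`, `z'` of `S₀`, are
paths of `H`. -/
structure IsSpan {V : Type*} (G H : SimpleGraph V) (Z S S₀ X : Set V) (u u' z z' : V)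
    (F M F' : Set V) : Prop where
  z_mem : z ∈ S₀
  z_mem' : z' ∈ S₀
  z_mem_X : z ∈ X
  z_mem_X' : z' ∈ X
  M_sub : M ⊆ X
  M_disj : ∀ x ∈ M, x ∉ S
  F_sub : F ⊆ insert z M
  F_sub' : F' ⊆ insert z' M
  F_conn : H.ConnOn F
  F_conn' : H.ConnOn F'
  M_conn : G.ConnOn M
  disj : ∀ x ∈ F, x ∉ F'
  z_mem_F : z ∈ F
  z_mem_F' : z' ∈ F'
  u_mem_F : u ∈ F
  u_mem_F' : u' ∈ F'
  u_mem_M : u ∈ M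
  u_mem_M' : u' ∈ M
  u_mem_Z : u ∈ Z
  u_mem_Z' : u' ∈ Z

theorem IsSpan.symm {V : Type*} {G H : SimpleGraph V} {Z S S₀ X : Set V} {u u' z z' : V}
    {F M F' : Set V} (h : IsSpan G H Z S S₀ X u u' z z' F M F') :
    IsSpan G H Z S S₀ X u' u z' z F' M F :=
  ⟨h.z_mem', h.z_mem, h.z_mem_X', h.z_mem_X, h.M_sub, h.M_disj, h.F_sub', h.F_sub, h.F_conn',
    h.F_conn, h.M_conn, fun x hx hx' => h.disj x hx' hx, h.z_mem_F', h.z_mem_F, h.u_mem_F',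
    h.u_mem_F, h.u_mem_M', h.u_mem_M, h.u_mem_Z', h.u_mem_Z⟩

/-- The graph of the pairs of vertices of `Z` that span a subpath away from `S`. -/
def spanGraph {V : Type*} (G H : SimpleGraph V) (Z S S₀ X : Set V) : SimpleGraph V where
  Adj u u' := ∃ z z' F M F', IsSpan G H Z S S₀ X u u' z z' F M F'
  symm := ⟨fun _ _ ⟨z, z', F, M, F', h⟩ => ⟨z', z, F', M, F, h.symm⟩⟩
  loopless := ⟨fun _ ⟨_, _, _, _, _, h⟩ => h.disj _ h.u_mem_F h.u_mem_F'⟩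

theorem exists_first {P : ℕ → Prop} {i j : ℕ} (h : ∃ k, i < k ∧ k < j ∧ P k) :
    ∃ k, i < k ∧ k < j ∧ P k ∧ ∀ k', i < k' → k' < k → ¬ P k' := by
  classical
  obtain ⟨h1, h2, h3⟩ := Nat.find_spec h
  exact ⟨_, h1, h2, h3, fun k' hk hk' hP => Nat.find_min h hk' ⟨hk, by omega, hP⟩⟩

theorem exists_last {P : ℕ → Prop} {i j : ℕ} (h : ∃ k, i < k ∧ k < j ∧ P k) :
    ∃ k, i < k ∧ k < j ∧ P k ∧ ∀ k', k < k' → k' < j → ¬ P k' := by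
  obtain ⟨k, h1, h2, h3⟩ := h
  obtain ⟨k', hk1, hk2, hk3, hk4⟩ := exists_first (P := fun x => P (j - x)) (i := 0) (j := j - i)
    ⟨j - k, by omega, by omega, by rwa [show j - (j - k) = k by omega]⟩
  exact ⟨j - k', by omega, by omega, hk3, fun x hx hxj hP => hk4 (j - x) (by omega) (by omega)
    (by rwa [show j - (j - x) = x by omega])⟩

namespace CrossConfig

variable {V : Type*} {G H : SimpleGraph V} {BV Z P₁ : Set V} {w p g : ℕ → V} {t N m l : ℕ}

/-- A path of `G` from `S` to a vertex separated by `S` from `Z` decomposes into paths of `H` and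
segments spanned by pairs of vertices of `Z`. -/
theorem joinedWithin_spanGraph (h : CrossConfig G H BV Z P₁ w p g t N m l) {S S₀ : Set V}
    {q : ℕ → V} {n : ℕ} (hq : ∀ k < n, G.Adj (q k) (q (k + 1))) (hinj : Set.InjOn q (Set.Iic n))
    (h0 : q 0 ∈ S) (hSB : S ⊆ BV) (hSZ : ∀ x ∈ S, x ∉ Z)
    (hS₀ : ∀ k ≤ n, q k ∈ S → q k ∉ S₀ → (k < n → q (k + 1) ∈ S) ∧ (0 < k → q (k - 1) ∈ S))
    (hnB : q n ∈ BV) (hnZ : q n ∉ Z)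
    (hend : ∀ F z, H.ConnOn F → q n ∈ F → z ∈ F → z ∈ Z → ∃ x ∈ F, x ∈ S) :
    (H ⊔ spanGraph G H Z S S₀ (q '' Set.Iic n)).JoinedWithin (q '' Set.Iic n) (q 0) (q n) := by
  set X := q '' Set.Iic n with hX
  set C := spanGraph G H Z S S₀ X with hC
  have hmem : ∀ {i j k : ℕ}, i ≤ k → k ≤ j → q k ∈ q '' Set.Icc i j := fun h1 h2 =>
    ⟨_, ⟨h1, h2⟩, rfl⟩
  have hsub : ∀ {i j : ℕ}, j ≤ n → q '' Set.Icc i j ⊆ X := by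
    rintro i j hj _ ⟨k, hk, rfl⟩
    exact ⟨k, hk.2.trans hj, rfl⟩
  have lift : ∀ {i j : ℕ}, i ≤ j → j ≤ n → H.ConnOn (q '' Set.Icc i j) →
      (H ⊔ C).JoinedWithin X (q i) (q j) := fun hij hj hF =>
    ((hF _ (hmem le_rfl hij) _ (hmem hij le_rfl)).mono (hsub hj)).mono_graph le_sup_left
  have between : ∀ i j, i < j → j ≤ n → q i ∈ S → q j ∈ S → (∀ k, i < k → k < j → q k ∉ S) →
      (H ⊔ C).JoinedWithin X (q i) (q j) := by
    intro i j hij hj hiS hjS hno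
    have hqj : ∀ k < j, G.Adj (q k) (q (k + 1)) := fun k hk => hq k (by omega)
    -- Between consecutive visits to `S`, the path is in `H` before its first and after its last
    -- vertex of `Z`. Only the stretch in between may leave `H`, and one virtual edge replaces it.
    by_cases hZ : ∃ k, i < k ∧ k < j ∧ q k ∈ Z
    · obtain ⟨a, hia, haj, haZ, hfirst⟩ := exists_first hZ
      obtain ⟨b, hib, hbj, hbZ, hlast⟩ := exists_last hZ
      have hab : a ≤ b := by
        by_contra! hlt
        exact hlast a hlt haj haZ
      have hFc : H.ConnOn (q '' Set.Icc i a) := by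
        refine connOn_image_Icc (h.adj_forward (fun k hk => hqj k (by omega)) (hSB hiS) ?_)
        intro k hik hka
        rcases hik.lt_or_eq with hik | rfl
        · exact hfirst k hik hka
        · exact hSZ _ hiS
      have hFc' : H.ConnOn (q '' Set.Icc b j) := by
        refine connOn_image_Icc (h.adj_backward (fun k hk => hqj k (by omega)) (hSB hjS) ?_)
        intro k hbk hkj
        rcases hkj.lt_or_eq with hkj | rfl
        · exact hlast k hbk hkj
        · exact hSZ _ hjS
      rcases hab.lt_or_eq with hab | rfl
      · refine (lift hia.le (by omega) hFc).trans (JoinedWithin.trans ?_ (lift hbj.le hj hFc'))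
        refine .of_adj (Or.inr ?_) ⟨a, by simp only [Set.mem_Iic]; omega, rfl⟩
          ⟨b, by simp only [Set.mem_Iic]; omega, rfl⟩
        have hne : ∀ x ≤ n, ∀ y ≤ n, q x = q y → x = y := fun x hx y hy e => hinj hx hy e
        refine ⟨q i, q j, q '' Set.Icc i a, q '' Set.Icc (i + 1) (j - 1), q '' Set.Icc b j, ?_, ?_,
          ⟨i, by simp only [Set.mem_Iic]; omega, rfl⟩, ⟨j, hj, rfl⟩, hsub (by omega), ?_, ?_, ?_,
          hFc, hFc', connOn_image_Icc fun k _ hk => hq k (by omega), ?_, hmem le_rfl hia.le,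
          hmem hbj.le le_rfl, hmem hia.le le_rfl, hmem le_rfl hbj.le, hmem hia (by omega),
          hmem (by omega) (by omega), haZ, hbZ⟩
        -- By `hS₀`, a foot outside `S₀` would be followed on the path by another vertex of `S`, but
        -- the stretch has none in its interior.
        · by_contra hi0
          exact hno (i + 1) (by omega) (by omega) ((hS₀ i (by omega) hiS hi0).1 (by omega))
        · by_contra hj0
          exact hno (j - 1) (by omega) (by omega) ((hS₀ j (by omega) hjS hj0).2 (by omega))
        · rintro _ ⟨k, hk, rfl⟩
          exact hno k hk.1 (by have := hk.2; omega)
        · rintro _ ⟨k, hk, rfl⟩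
          rcases hk.1.lt_or_eq with hik | rfl
          · exact .inr (hmem hik (by have := hk.2; omega))
          · exact .inl rfl
        · rintro _ ⟨k, hk, rfl⟩
          rcases hk.2.lt_or_eq with hik | rfl
          · exact .inr (hmem (by have := hk.1; omega) (by omega))
          · exact .inl rfl
        · rintro _ ⟨k, hk, rfl⟩ ⟨k', hk', e⟩
          have := hne k (by have := hk.2; omega) k' (by have := hk'.2; omega) e.symm
          have := hk.2
          have := hk'.1
          omega
      · exact (lift hia.le (by omega) hFc).trans (lift hbj.le hj hFc')
    · push Not at hZ
      refine lift hij.le hj (connOn_image_Icc (h.adj_forward hqj (hSB hiS) ?_))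
      intro k hik hkj
      rcases hik.lt_or_eq with hik | rfl
      · exact hZ k hik hkj
      · exact hSZ _ hiS
  have toS : ∀ k ≤ n, q k ∈ S → (H ⊔ C).JoinedWithin X (q 0) (q k) := by
    intro k
    induction k using Nat.strong_induction_on with
    | _ k ih =>
      intro hk hkS
      rcases Nat.eq_zero_or_pos k with rfl | hk0
      · exact .refl ⟨0, Nat.zero_le _, rfl⟩
      by_cases hprev : ∃ j, 0 < j ∧ j < k ∧ q j ∈ S
      · obtain ⟨j, hj0, hjk, hjS, hlast⟩ := exists_last hprev
        exact (ih j hjk (by omega) hjS).trans (between j k hjk hk hjS hkS hlast)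
      · push Not at hprev
        exact between 0 k hk0 hk h0 hkS hprev
  obtain ⟨i, hin, hiS, hlast⟩ : ∃ i ≤ n, q i ∈ S ∧ ∀ k, i < k → k ≤ n → q k ∉ S := by
    by_cases hex : ∃ i, 0 < i ∧ i < n + 1 ∧ q i ∈ S
    · obtain ⟨i, -, h2, h3, h4⟩ := exists_last hex
      exact ⟨i, by omega, h3, fun k hk hkn => h4 k hk (by omega)⟩
    · push Not at hex
      exact ⟨0, Nat.zero_le _, h0, fun k hk hkn => hex k hk (by omega)⟩
  refine (toS i hin hiS).trans ?_
  by_cases hZ : ∃ k, i < k ∧ k < n ∧ q k ∈ Z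
  -- After the last visit to `S`, a last vertex of `Z` would be joined to `q n` in `H` without
  -- meeting `S`, contrary to `hend`.
  · exfalso
    obtain ⟨b, hib, hbn, hbZ, hlastZ⟩ := exists_last hZ
    have hF : H.ConnOn (q '' Set.Icc b n) := by
      refine connOn_image_Icc (h.adj_backward hq hnB ?_)
      intro k hbk hkj
      rcases hkj.lt_or_eq with hkj | rfl
      · exact hlastZ k hbk hkj
      · exact hnZ
    obtain ⟨_, ⟨k, hk, rfl⟩, hkS⟩ := hend _ _ hF (hmem hbn.le le_rfl) (hmem le_rfl hbn.le) hbZ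
    exact hlast k (by have := hk.1; omega) hk.2 hkS
  · push Not at hZ
    refine lift hin le_rfl (connOn_image_Icc (h.adj_forward hq (hSB hiS) ?_))
    intro k hik hkj
    rcases hik.lt_or_eq with hik | rfl
    · exact hZ k hik hkj
    · exact hSZ _ hiS

end CrossConfig

/-! ### Legs, the frame, and the resulting `K₃,₃` -/

/-- A connected set `L ⊆ X` of `H` that leads from `u` to the vertex `p i`, where it first meets the
path `p`. -/
structure IsLeg {V : Type*} (H : SimpleGraph V) (BV P₁ : Set V) (p g : ℕ → V) (m l : ℕ)
    (L X : Set V) (i : ℕ) (u : V) : Prop where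
  i_le : i ≤ m
  conn : H.ConnOn L
  conn_insert : H.ConnOn (insert (p i) L)
  u_mem : u ∈ L
  sub : L ⊆ X
  p_mem : p i ∈ X
  p_notMem : ∀ j ≤ m, p j ∉ L
  notMem_P₁ : ∀ x ∈ L, x ∉ P₁
  mem_BV : ∀ x ∈ L, x ∈ BV
  g_mem : ∃ k ≤ l, g k ∈ L

theorem CrossConfig.exists_isLeg {V : Type*} {G H : SimpleGraph V} {BV Z P₁ : Set V}
    {w p g : ℕ → V} {t N m l : ℕ} (h : CrossConfig G H BV Z P₁ w p g t N m l)
    {q : ℕ → V} {n e : ℕ} (hq : ∀ k < n, G.Adj (q k) (q (k + 1)))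
    (h0 : q 0 = w e) (he : 3 ≤ e) (het : e + 2 ≤ t) (hZ : ∃ k ≤ n, q k ∈ Z) :
    ∃ α ≤ n, ∃ i, q α = p i ∧
      IsLeg H BV P₁ p g m l (q '' Set.Iio α) (q '' Set.Iic n) i (w e) := by
  obtain ⟨α, hαn, i, him, hqi, hadj, hα, j, hjα, k, hk, e'⟩ := h.exists_leg hq h0 he het hZ
  have e1 : q '' Set.Iio α = q '' Set.Icc 0 (α - 1) := by
    congr 1; ext x; simp only [Set.mem_Iio, Set.mem_Icc]; omega
  have e2 : insert (p i) (q '' Set.Iio α) = q '' Set.Icc 0 α := by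
    rw [← hqi, ← Set.image_insert_eq]
    congr 1; ext x; simp only [Set.mem_insert_iff, Set.mem_Iio, Set.mem_Icc]; omega
  refine ⟨α, hαn, i, hqi, him, ?_, ?_, ⟨0, by simp only [Set.mem_Iio]; omega, h0⟩, ?_,
    ⟨α, hαn, hqi⟩, ?_, ?_, ?_, k, hk, j, hjα, e'⟩
  · rw [e1]
    exact connOn_image_Icc fun k _ hk => hadj k (by omega)
  · rw [e2]
    exact connOn_image_Icc fun k _ hk => hadj k hk
  · exact Set.image_mono fun x hx => by simp only [Set.mem_Iio, Set.mem_Iic] at *; omega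
  · rintro j hj ⟨x, hx, e⟩
    exact (hα x hx).2.2 j hj e
  · rintro _ ⟨x, hx, rfl⟩
    exact (hα x hx).2.1
  · rintro _ ⟨x, hx, rfl⟩
    exact (hα x hx).1

/-- A subpath of `g` that joins `L` to `R` without meeting `L ∪ R` in between. -/
theorem exists_middle {V : Type*} {H : SimpleGraph V} {g : ℕ → V} {l : ℕ} {L R : Set V}
    (hg : ∀ i < l, H.Adj (g i) (g (i + 1))) (hLR : Disjoint L R) {i j : ℕ} (hi : i ≤ l)
    (hj : j ≤ l) (hiL : g i ∈ L) (hjR : g j ∈ R) :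
    ∃ P ⊆ g '' Set.Iic l, H.ConnOn P ∧ (∃ y ∈ P, y ∈ L) ∧ (∃ y ∈ P, y ∈ R) ∧
      ∀ x ∈ P, x ∉ L → x ∉ R →
        (∃ F ⊆ P, H.ConnOn F ∧ x ∈ F ∧ (∃ y ∈ F, y ∈ L) ∧ ∀ y ∈ F, y ∉ R) ∧
        ∃ F ⊆ P, H.ConnOn F ∧ x ∈ F ∧ (∃ y ∈ F, y ∈ R) ∧ ∀ y ∈ F, y ∉ L := by
  wlog hij : i < j generalizing i j L R
  · have hne : i ≠ j := by
      rintro rfl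
      exact Set.disjoint_left.1 hLR hiL hjR
    obtain ⟨P, h1, h2, h3, h4, h5⟩ := this hLR.symm hj hi hjR hiL (by omega)
    exact ⟨P, h1, h2, h4, h3, fun x hx hxL hxR => (h5 x hx hxR hxL).symm⟩
  -- `b` is the first visit to `R` after `i`, and `a` below is the last visit to `L` before `b`. The
  -- stretch between them meets `L ∪ R` only at its ends.
  obtain ⟨b, hib, hbj, hbR, hfirst⟩ := exists_first (P := fun k => g k ∈ R) (i := i) (j := j + 1)
    ⟨j, hij, by omega, hjR⟩
  obtain ⟨a, hia, hab, haL, hlast⟩ : ∃ a, i ≤ a ∧ a < b ∧ g a ∈ L ∧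
      ∀ k, a < k → k < b → g k ∉ L := by
    by_cases hex : ∃ k, i < k ∧ k < b ∧ g k ∈ L
    · obtain ⟨a, h1, h2, h3, h4⟩ := exists_last hex
      exact ⟨a, h1.le, h2, h3, h4⟩
    · push Not at hex
      exact ⟨i, le_rfl, hib, hiL, hex⟩
  have hconn : ∀ i j, j ≤ l → H.ConnOn (g '' Set.Icc i j) := fun i j hj =>
    connOn_image_Icc fun k _ hk => hg k (by omega)
  have hsub : ∀ i j, a ≤ i → j ≤ b → g '' Set.Icc i j ⊆ g '' Set.Icc a b := fun i j hi hj =>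
    Set.image_mono (Set.Icc_subset_Icc hi hj)
  have hmem : ∀ {i j k : ℕ}, i ≤ k → k ≤ j → g k ∈ g '' Set.Icc i j := fun h1 h2 =>
    ⟨_, ⟨h1, h2⟩, rfl⟩
  refine ⟨g '' Set.Icc a b, Set.image_mono fun x hx => by
      simp only [Set.mem_Icc, Set.mem_Iic] at *; omega, hconn _ _ (by omega),
    ⟨_, hmem le_rfl hab.le, haL⟩, ⟨_, hmem hab.le le_rfl, hbR⟩, ?_⟩
  rintro _ ⟨k, ⟨hak, hkb⟩, rfl⟩ hkL hkR
  have hak : a < k := lt_of_le_of_ne hak fun e => hkL (e ▸ haL)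
  have hkb : k < b := lt_of_le_of_ne hkb fun e => hkR (e ▸ hbR)
  refine ⟨⟨g '' Set.Icc a k, hsub _ _ le_rfl hkb.le, hconn _ _ (by omega), hmem hak.le le_rfl,
    ⟨_, hmem le_rfl hak.le, haL⟩, ?_⟩, g '' Set.Icc k b, hsub _ _ hak.le le_rfl,
    hconn _ _ (by omega), hmem le_rfl hkb.le, ⟨_, hmem hkb.le le_rfl, hbR⟩, ?_⟩
  · rintro _ ⟨x, hx, rfl⟩
    rcases hx.1.lt_or_eq with hax | rfl
    · exact hfirst x (by omega) (by have := hx.2; omega)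
    · exact Set.disjoint_left.1 hLR haL
  · rintro _ ⟨x, hx, rfl⟩
    rcases hx.2.lt_or_eq with hxb | rfl
    · exact hlast x (by have := hx.1; omega) hxb
    · exact Set.disjoint_right.1 hLR hbR

/-- A path of `H` from `w a` to `w d` made of a part of `p` and two legs. -/
structure IsFrame {V : Type*} (G H : SimpleGraph V) (BV Z P₁ : Set V) (w p g : ℕ → V)
    (t N m l : ℕ) (L R X Y : Set V) (i i' a d : ℕ) : Prop where
  config : CrossConfig G H BV Z P₁ w p g t N m l
  left : IsLeg H BV P₁ p g m l L X i (w a)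
  right : IsLeg H BV P₁ p g m l R Y i' (w d)
  ha : 3 ≤ a
  had : a < d
  hd : d + 2 ≤ t
  hXY : Disjoint X Y

namespace IsFrame

variable {V : Type*} {G H : SimpleGraph V} {BV Z P₁ : Set V} {w p g : ℕ → V} {t N m l : ℕ}
  {L R X Y : Set V} {i i' a d : ℕ}

/-- The vertices of the frame. -/
def verts (p : ℕ → V) (L R : Set V) (i i' : ℕ) : Set V := L ∪ p '' Set.Icc i i' ∪ R

section
variable (f : IsFrame G H BV Z P₁ w p g t N m l L R X Y i i' a d)
include f

theorem disjoint_legs : ∀ x ∈ L, x ∉ R := fun _ hx hx' =>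
  Set.disjoint_left.1 f.hXY (f.left.sub hx) (f.right.sub hx')

theorem p_ne {j : ℕ} (hj : j ≤ m) {k : ℕ} (hk : k ≤ m) (h : j ≠ k) : p j ≠ p k := fun e =>
  h (f.config.p_injOn hj hk e)

theorem connOn_left {j : ℕ} (hij : i ≤ j) (hj : j ≤ m) : H.ConnOn (L ∪ p '' Set.Icc i j) := by
  have : L ∪ p '' Set.Icc i j = insert (p i) L ∪ p '' Set.Icc i j := by
    rw [Set.insert_union, Set.insert_eq_of_mem]
    exact .inr ⟨i, ⟨le_rfl, hij⟩, rfl⟩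
  rw [this]
  exact f.left.conn_insert.union (f.config.connOn_p hj) (Set.mem_insert _ _)
    ⟨i, ⟨le_rfl, hij⟩, rfl⟩

theorem connOn_right {j : ℕ} (hji : j ≤ i') : H.ConnOn (R ∪ p '' Set.Icc j i') := by
  have : R ∪ p '' Set.Icc j i' = insert (p i') R ∪ p '' Set.Icc j i' := by
    rw [Set.insert_union, Set.insert_eq_of_mem]
    exact .inr ⟨i', ⟨hji, le_rfl⟩, rfl⟩
  rw [this]
  exact f.right.conn_insert.union (f.config.connOn_p f.right.i_le) (Set.mem_insert _ _)
    ⟨i', ⟨hji, le_rfl⟩, rfl⟩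

/-- Equality would give `X` and `Y` a common vertex. If `i' < i`, then `R` with the start of `p`
joins `w 2` to `w d`, crossing `L` with the end of `p` from `w a` to `w (t - 1)`. -/
theorem i_lt : i < i' := by
  have hne : i ≠ i' := by
    rintro rfl
    exact Set.disjoint_left.1 f.hXY f.left.p_mem f.right.p_mem
  by_contra! hle
  have htN := f.config.ht
  have ha := f.ha
  have had := f.had
  have hd := f.hd
  refine f.config.crossFree.false_of_connOn (a := 2) (b := a) (c := d) (d := t - 1) le_rfl
    (by omega) f.had (by omega) (by omega) (f.connOn_right (Nat.zero_le _))
    (f.connOn_left f.left.i_le le_rfl)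
    (.inr ⟨0, ⟨le_rfl, Nat.zero_le _⟩, f.config.p_zero⟩) (.inl f.right.u_mem) (.inl f.left.u_mem)
    (.inr ⟨m, ⟨f.left.i_le, le_rfl⟩, f.config.p_last⟩) ?_
  rw [Set.disjoint_left]
  rintro x (hx | ⟨j, hj, rfl⟩) (hx' | ⟨k, hk, e⟩)
  · exact f.disjoint_legs x hx' hx
  · exact f.right.p_notMem k hk.2 (e ▸ hx)
  · exact f.left.p_notMem j (hj.2.trans f.right.i_le) hx'
  · exact f.p_ne hk.2 (hj.2.trans f.right.i_le) (by have := hj.2; have := hk.1; omega) e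

theorem verts_mem_BV : verts p L R i i' ⊆ BV := by
  rintro x ((hx | ⟨j, hj, rfl⟩) | hx)
  · exact f.left.mem_BV x hx
  · have := f.ha
    have := f.had
    have := f.hd
    exact f.config.p_mem_BV (by omega) (hj.2.trans f.right.i_le)
  · exact f.right.mem_BV x hx

theorem verts_notMem_P₁ : ∀ x ∈ verts p L R i i', x ∉ P₁ := by
  rintro x ((hx | ⟨j, hj, rfl⟩) | hx)
  · exact f.left.notMem_P₁ x hx
  · exact f.config.p_notMem j (hj.2.trans f.right.i_le)
  · exact f.right.notMem_P₁ x hx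

theorem connOn_verts : H.ConnOn (verts p L R i i') := by
  have : verts p L R i i' = (L ∪ p '' Set.Icc i i') ∪ (R ∪ p '' Set.Icc i' i') := by
    have hi : p i' ∈ verts p L R i i' := .inl (.inr ⟨i', ⟨f.i_lt.le, le_rfl⟩, rfl⟩)
    rw [Set.Icc_self, Set.image_singleton, ← Set.union_assoc]
    exact (Set.union_eq_self_of_subset_right (by simpa using hi)).symm
  rw [this]
  exact (f.connOn_left f.i_lt.le f.right.i_le).union (f.connOn_right le_rfl)
    (.inr ⟨i', ⟨f.i_lt.le, le_rfl⟩, rfl⟩) (.inr ⟨i', ⟨le_rfl, le_rfl⟩, rfl⟩)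

/-- The frame separates `w e`, `a < e < d`, from `Z` in `H`. -/
theorem exists_mem_verts {F : Set V} {e : ℕ} {z : V} (hae : a < e) (hed : e < d)
    (hF : H.ConnOn F) (heF : w e ∈ F) (hzF : z ∈ F) (hz : z ∈ Z) :
    ∃ x ∈ F, x ∈ verts p L R i i' := by
  by_contra! hcon
  rw [f.config.Z_eq] at hz
  obtain ⟨k, hk, rfl⟩ := hz
  have := f.ha
  have := f.hd
  exact f.config.crossFree.false_of_connOn (a := a) (b := e) (c := d) (d := k) (by omega) hae hed
    (by have := hk.1; omega) hk.2 f.connOn_verts hF (.inl (.inl f.left.u_mem))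
    (.inr f.right.u_mem) heF hzF (Set.disjoint_right.2 hcon)

/-- Disjoint paths from the frame to `w k`, `w k'` start from `p` in the opposite order. -/
theorem foot_lt {F F' : Set V} {j j' k k' : ℕ} (hF : H.ConnOn F) (hF' : H.ConnOn F')
    (hj : j ∈ Set.Icc i i') (hj' : j' ∈ Set.Icc i i') (hjF : p j ∈ F) (hjF' : p j' ∈ F')
    (hFS : ∀ x ∈ F, x ∈ verts p L R i i' → x = p j)
    (hFS' : ∀ x ∈ F', x ∈ verts p L R i i' → x = p j')
    (hkF : w k ∈ F) (hkF' : w k' ∈ F') (hdis : ∀ x ∈ F, x ∉ F') (htk : t ≤ k) (hkk : k < k')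
    (hkN : k' ≤ N) : j' < j := by
  have him := f.right.i_le
  have hjj : j ≠ j' := by
    rintro rfl
    exact hdis _ hjF hjF'
  by_contra! hle
  -- In this order, `L`, `p` up to `j` and `F` join `w a` to `w k`, while `R`, `p` from `j'` on and
  -- `F'` join `w d` to `w k'`: a cross, as `a < d < k < k'`.
  have hlt : j < j' := by omega
  have hj2 := hj.2
  have hj2' := hj'.2
  have := f.ha
  have := f.hd
  refine f.config.crossFree.false_of_connOn (a := a) (b := d) (c := k) (d := k') (by omega) f.had
    (by omega) hkk hkN
    ((f.connOn_left hj.1 (hj.2.trans him)).union hF (.inr ⟨j, ⟨hj.1, le_rfl⟩, rfl⟩) hjF)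
    ((f.connOn_right hj'.2).union hF' (.inr ⟨j', ⟨le_rfl, hj'.2⟩, rfl⟩) hjF')
    (.inl (.inl f.left.u_mem)) (.inr hkF) (.inl (.inl f.right.u_mem)) (.inr hkF') ?_
  rw [Set.disjoint_left]
  rintro x ((hx | ⟨y, hy, rfl⟩) | hx) ((hx' | ⟨y', hy', e⟩) | hx')
  · exact f.disjoint_legs x hx hx'
  · exact f.left.p_notMem y' (hy'.2.trans him) (e ▸ hx)
  · have := hFS' x hx' (.inl (.inl hx))
    exact f.left.p_notMem j' (hj'.2.trans him) (this ▸ hx)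
  · exact f.right.p_notMem y (by have := hy.2; omega) hx'
  · exact f.p_ne (by have := hy'.2; omega) (by have := hy.2; omega)
      (by have := hy.2; have := hy'.1; omega) e
  · have := hFS' _ hx' (.inl (.inr ⟨y, ⟨hy.1, by have := hy.2; omega⟩, rfl⟩))
    exact f.p_ne (by have := hy.2; omega) (by omega) (by have := hy.2; omega) this
  · have := hFS x hx (.inr hx')
    exact f.right.p_notMem j (hj.2.trans him) (this ▸ hx')
  · have := hFS x hx (.inl (.inr ⟨y', ⟨by have := hy'.1; have := hj.1; omega, hy'.2⟩, e⟩))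
    rw [← e] at this
    exact f.p_ne (by have := hy'.2; omega) (by omega) (by have := hy'.1; omega) this
  · exact hdis x hx hx'

/-- A connected set of `G` that meets `Z` and avoids the frame avoids the part of `g` between the
legs of the frame. -/
theorem notMem_middle {P M : Set V} (hP : P ⊆ g '' Set.Iic l)
    (hmid : ∀ x ∈ P, x ∉ L → x ∉ R →
        (∃ F ⊆ P, H.ConnOn F ∧ x ∈ F ∧ (∃ y ∈ F, y ∈ L) ∧ ∀ y ∈ F, y ∉ R) ∧
        ∃ F ⊆ P, H.ConnOn F ∧ x ∈ F ∧ (∃ y ∈ F, y ∈ R) ∧ ∀ y ∈ F, y ∉ L)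
    (hM : G.ConnOn M) (hMS : ∀ x ∈ M, x ∉ verts p L R i i') {u : V} (hu : u ∈ M) (huZ : u ∈ Z) :
    ∀ x ∈ M, x ∉ P := by
  intro x hxM hxP
  have ht6 : 6 ≤ t := by
    have := f.ha
    have := f.had
    have := f.hd
    omega
  have htN := f.config.ht
  have ha := f.ha
  have had := f.had
  have hd := f.hd
  have him := f.right.i_le
  have hii := f.i_lt
  obtain ⟨k, hk, rfl⟩ := hP hxP
  have hP2 : ∀ y ∈ P, ∀ j ≤ m, p j ≠ y := by
    intro y hy j hj e
    obtain ⟨k', hk', rfl⟩ := hP hy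
    exact f.config.p_ne_g j hj k' hk' e
  -- From a common vertex with `P`, follow `M` to its first vertex in `Z` or on `p`. Reaching `Z`
  -- first contradicts separation by `p`.
  obtain ⟨s, hs, F, hFM, hF, hkF, hsF, hFD⟩ := f.config.exists_hit
    (D := Z ∪ p '' Set.Iic m) Set.subset_union_left (hM _ hxM _ hu) (.inl huZ)
    (f.config.g_mem_BV ht6 hk)
  by_cases hsp : s ∈ p '' Set.Iic m
  · obtain ⟨n, hn, rfl⟩ := hsp
    obtain ⟨⟨A, hAP, hA, hkA, ⟨y, hyA, hyL⟩, hAR⟩, B, hBP, hB, hkB, ⟨y', hyB, hyR⟩, hBL⟩ :=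
      hmid _ hxP (fun hL => hMS _ hxM (.inl (.inl hL))) (fun hR => hMS _ hxM (.inr hR))
    have hFp : ∀ x ∈ F, ∀ j ≤ m, p j = x → j = n := by
      rintro _ hx j hj rfl
      exact f.config.p_injOn hj hn (hFD _ hx (.inr ⟨j, hj, rfl⟩))
    have hnS : n < i ∨ i' < n := by
      by_contra! hcon
      exact hMS _ (hFM hsF) (.inl (.inr ⟨n, hcon, rfl⟩))
    -- The vertex reached on `p` is outside the frame. If it comes before `i`, then `p`, `F`, a
    -- piece of `g` and `R` join `w 2` to `w d`, crossing `L` with the end of `p`; the case after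
    -- `i'` is symmetric.
    rcases hnS with hni | hni
    · refine f.config.crossFree.false_of_connOn (a := 2) (b := a) (c := d) (d := t - 1) le_rfl
        (by omega) had (by omega) (by omega)
        ((((f.config.connOn_p (i := 0) hn).union hF ⟨n, ⟨Nat.zero_le _, le_rfl⟩, rfl⟩ hsF).union hB
          (.inr hkF) hkB).union f.right.conn (.inr hyB) hyR)
        (f.connOn_left f.left.i_le le_rfl)
        (.inl (.inl (.inl ⟨0, ⟨le_rfl, Nat.zero_le _⟩, f.config.p_zero⟩))) (.inr f.right.u_mem)
        (.inl f.left.u_mem) (.inr ⟨m, ⟨f.left.i_le, le_rfl⟩, f.config.p_last⟩) ?_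
      rw [Set.disjoint_left]
      rintro x (((⟨j, hj, rfl⟩ | hx) | hx) | hx) (hx' | ⟨j', hj', e⟩)
      · exact f.left.p_notMem j (hj.2.trans hn) hx'
      · exact f.p_ne hj'.2 (hj.2.trans hn) (by have := hj.2; have := hj'.1; omega) e
      · exact hMS x (hFM hx) (.inl (.inl hx'))
      · have := hFp x hx j' hj'.2 e
        have := hj'.1
        omega
      · exact hBL x hx hx'
      · exact hP2 x (hBP hx) j' hj'.2 e
      · exact f.disjoint_legs x hx' hx
      · exact f.right.p_notMem j' hj'.2 (e ▸ hx)
    · refine f.config.crossFree.false_of_connOn (a := 2) (b := a) (c := d) (d := t - 1) le_rfl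
        (by omega) had (by omega) (by omega) (f.connOn_right (Nat.zero_le _))
        ((((f.config.connOn_p (i := n) le_rfl).union hF ⟨n, ⟨le_rfl, hn⟩, rfl⟩ hsF).union hA
          (.inr hkF) hkA).union f.left.conn (.inr hyA) hyL)
        (.inr ⟨0, ⟨le_rfl, Nat.zero_le _⟩, f.config.p_zero⟩) (.inl f.right.u_mem)
        (.inr f.left.u_mem) (.inl (.inl (.inl ⟨m, ⟨hn, le_rfl⟩, f.config.p_last⟩))) ?_
      rw [Set.disjoint_right]
      rintro x (((⟨j, hj, rfl⟩ | hx) | hx) | hx) (hx' | ⟨j', hj', e⟩)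
      · exact f.right.p_notMem j hj.2 hx'
      · exact f.p_ne (hj'.2.trans him) hj.2 (by have := hj.1; have := hj'.2; omega) e
      · exact hMS x (hFM hx) (.inr hx')
      · have := hFp x hx j' (hj'.2.trans him) e
        have := hj'.2
        omega
      · exact hAR x hx hx'
      · exact hP2 x (hAP hx) j' (hj'.2.trans him) e
      · exact f.disjoint_legs x hx hx'
      · exact f.left.p_notMem j' (hj'.2.trans him) (e ▸ hx)
  · refine f.config.false_of_g_avoids_p ht6 hk hF hkF hsF (hs.resolve_right hsp) ?_
    intro j hj hjF
    exact hsp ⟨j, hj, hFD _ hjF (.inr ⟨j, hj, rfl⟩)⟩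

/-- Two spans whose ends interleave yield a `K₃,₃`. -/
theorem not_isPlanarGraph {X₁ X₂ : Set V} (hX : Disjoint X₁ X₂) {k₁ k₂ k₃ k₄ : ℕ}
    (h12 : k₁ < k₂) (h23 : k₂ < k₃) (h34 : k₃ < k₄) (ht1 : t ≤ k₁) (h4N : k₄ ≤ N)
    {z₁ z₂ z₃ z₄ : V} {F₁ F₂ F₃ F₄ M M' : Set V}
    (s : IsSpan G H Z (verts p L R i i') (p '' Set.Icc i i') X₁ (w k₁) (w k₃) z₁ z₃ F₁ M F₃)
    (s' : IsSpan G H Z (verts p L R i i') (p '' Set.Icc i i') X₂ (w k₂) (w k₄) z₂ z₄ F₂ M' F₄) :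
    ¬ IsPlanarGraph G := by
  obtain ⟨n₁, hn₁, rfl⟩ := s.z_mem
  obtain ⟨n₃, hn₃, rfl⟩ := s.z_mem'
  obtain ⟨n₂, hn₂, rfl⟩ := s'.z_mem
  obtain ⟨n₄, hn₄, rfl⟩ := s'.z_mem'
  have him := f.right.i_le
  have hXX : ∀ x ∈ X₁, x ∉ X₂ := fun x hx hx' => Set.disjoint_left.1 hX hx hx'
  have foot : ∀ {X : Set V} {u u' z z' : V} {F M F' : Set V},
      IsSpan G H Z (verts p L R i i') (p '' Set.Icc i i') X u u' z z' F M F' →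
      (∀ x ∈ F, x ∈ verts p L R i i' → x = z) ∧ (∀ x ∈ F', x ∈ verts p L R i i' → x = z') ∧
      F ⊆ X ∧ F' ⊆ X := by
    intro X u u' z z' F M F' s
    refine ⟨fun x hx hxS => (s.F_sub hx).resolve_right fun hM => s.M_disj x hM hxS,
      fun x hx hxS => (s.F_sub' hx).resolve_right fun hM => s.M_disj x hM hxS, fun x hx => ?_,
      fun x hx => ?_⟩
    · rcases s.F_sub hx with rfl | hx
      exacts [s.z_mem_X, s.M_sub hx]
    · rcases s.F_sub' hx with rfl | hx
      exacts [s.z_mem_X', s.M_sub hx]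
  obtain ⟨f1, f3, x1, x3⟩ := foot s
  obtain ⟨f2, f4, x2, x4⟩ := foot s'
  have n21 : n₂ < n₁ := f.foot_lt s.F_conn s'.F_conn hn₁ hn₂ s.z_mem_F s'.z_mem_F f1 f2 s.u_mem_F
    s'.u_mem_F (fun x hx hx' => hXX x (x1 hx) (x2 hx')) ht1 h12 (by omega)
  have n32 : n₃ < n₂ := f.foot_lt s'.F_conn s.F_conn' hn₂ hn₃ s'.z_mem_F s.z_mem_F' f2 f3 s'.u_mem_F
    s.u_mem_F' (fun x hx hx' => hXX x (x3 hx') (x2 hx)) (by omega) h23 (by omega)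
  have n43 : n₄ < n₃ := f.foot_lt s.F_conn' s'.F_conn' hn₃ hn₄ s.z_mem_F' s'.z_mem_F' f3 f4
    s.u_mem_F' s'.u_mem_F' (fun x hx hx' => hXX x (x3 hx) (x4 hx')) (by omega) h34 h4N
  obtain ⟨y, hy, hyL⟩ := f.left.g_mem
  obtain ⟨y', hy', hyR⟩ := f.right.g_mem
  obtain ⟨P, hP, hPc, ⟨a₁, ha₁, haL⟩, ⟨a₂, ha₂, haR⟩, hmid⟩ := exists_middle f.config.g_adj
    (Set.disjoint_left.2 f.disjoint_legs) hy hy' hyL hyR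
  have hMP := f.notMem_middle hP hmid s.M_conn s.M_disj s.u_mem_M s.u_mem_Z
  have hMP' := f.notMem_middle hP hmid s'.M_conn s'.M_disj s'.u_mem_M s'.u_mem_Z
  have hpP : ∀ j ≤ m, p j ∉ P := by
    intro j hj hjP
    obtain ⟨k, hk, e⟩ := hP hjP
    exact f.config.p_ne_g j hj k hk e.symm
  -- `W` joins `p n₄` to `p n₁` the other way round: back along `p` to the left leg, along `g` to
  -- the right leg, and along `p` again. It avoids the part of `p` strictly between `n₄` and `n₁`.
  let W : Set V := L ∪ p '' Set.Icc i n₄ ∪ P ∪ (R ∪ p '' Set.Icc n₁ i')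
  have hW : H.ConnOn W := ((f.connOn_left hn₄.1 (hn₄.2.trans him)).union hPc (.inl haL) ha₁).union
    (f.connOn_right hn₁.2) (.inr ha₂) (.inl haR)
  have arc : ∀ {j k : ℕ}, i ≤ j → k ≤ i' → p '' Set.Icc j k ⊆ verts p L R i i' := by
    rintro j k hj hk _ ⟨x, hx, rfl⟩
    exact .inl (.inr ⟨x, ⟨hj.trans hx.1, hx.2.trans hk⟩, rfl⟩)
  have arc_joined : ∀ {j k : ℕ}, j ≤ k → k ≤ i' →
      G.JoinedWithin (p '' Set.Icc j k) (p j) (p k) := fun hjk hk =>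
    ((f.config.connOn_p (hk.trans him)) _ ⟨_, ⟨le_rfl, hjk⟩, rfl⟩ _
      ⟨_, ⟨hjk, le_rfl⟩, rfl⟩).mono_graph f.config.le
  have arc_disj : ∀ {M : Set V} {c j k : ℕ}, (∀ x ∈ M, x ∉ verts p L R i i') → c ≤ i' →
      i ≤ j → k ≤ i' → (c < j ∨ k < c) → ∀ {T : Set V}, T ⊆ insert (p c) M →
      Disjoint T (p '' Set.Icc j k) := by
    intro M c j k hM hc hj hk hcjk T hT
    rw [Set.disjoint_left]
    rintro x hx hx'
    rcases hT hx with rfl | hx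
    · obtain ⟨e, he, he'⟩ := hx'
      exact f.p_ne (he.2.trans (hk.trans him)) (hc.trans him)
        (by have := he.1; have := he.2; omega) he'
    · exact hM x hx (arc hj hk hx')
  have arc_W : ∀ {M : Set V} {c : ℕ}, (∀ x ∈ M, x ∉ verts p L R i i') → (∀ x ∈ M, x ∉ P) →
      n₄ < c → c < n₁ → ∀ {T : Set V}, T ⊆ insert (p c) M → Disjoint T W := by
    intro M c hM hMP hc4 hc1 T hT
    have hc : c ≤ m := by have := hn₁.2; omega
    rw [Set.disjoint_left]
    rintro x hx (((hx' | hx') | hx') | (hx' | hx'))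
    · rcases hT hx with rfl | hx
      exacts [f.left.p_notMem c hc hx', hM x hx (.inl (.inl hx'))]
    · exact Set.disjoint_left.1 (arc_disj hM (by have := hn₁.2; omega) le_rfl hn₄.2 (.inr hc4) hT)
        hx hx'
    · rcases hT hx with rfl | hx
      exacts [hpP c hc hx', hMP x hx hx']
    · rcases hT hx with rfl | hx
      exacts [f.right.p_notMem c hc hx', hM x hx (.inr hx')]
    · exact Set.disjoint_left.1 (arc_disj hM (by have := hn₁.2; omega) hn₁.1 le_rfl (.inl hc1) hT)
        hx hx'
  have P₁_arc : ∀ {j k : ℕ}, i ≤ j → k ≤ i' → Disjoint P₁ (p '' Set.Icc j k) := fun hj hk =>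
    Set.disjoint_right.2 fun x hx => f.verts_notMem_P₁ x (arc hj hk hx)
  have P₁_W : Disjoint P₁ W := by
    rw [Set.disjoint_right]
    rintro x (((hx | hx) | hx) | (hx | hx))
    · exact f.left.notMem_P₁ x hx
    · exact Set.disjoint_right.1 (P₁_arc le_rfl hn₄.2) hx
    · obtain ⟨k, hk, rfl⟩ := hP hx
      exact f.config.g_notMem k hk
    · exact f.right.notMem_P₁ x hx
    · exact Set.disjoint_right.1 (P₁_arc hn₁.1 le_rfl) hx
  have arc_arc : ∀ {j k j' k' : ℕ}, k < j' → k' ≤ i' →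
      Disjoint (p '' Set.Icc j k) (p '' Set.Icc j' k') := by
    intro j k j' k' hkj hk'
    rw [Set.disjoint_left]
    rintro _ ⟨e, he, rfl⟩ ⟨e', he', h⟩
    have := he.2
    have := he'.1
    have := he'.2
    exact f.p_ne (by omega) (by omega) (by omega) h
  have mid_W : Disjoint (p '' Set.Icc n₃ n₂) W := by
    rw [Set.disjoint_left]
    rintro _ ⟨e, he, rfl⟩ hx
    exact Set.disjoint_left.1 (arc_W (M := ∅) (c := e) (T := {p e}) (by simp) (by simp)
      (by have := he.1; omega) (by have := he.2; omega) (by simp)) (Set.mem_singleton _) hx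
  have hi4 := hn₄.1
  have hi1 := hn₁.2
  have sub3 : M ∪ F₃ ⊆ insert (p n₃) M := Set.union_subset (Set.subset_insert _ _) s.F_sub'
  have sub4 : M' ∪ F₄ ⊆ insert (p n₄) M' := Set.union_subset (Set.subset_insert _ _) s'.F_sub'
  have span_span : ∀ {T T' : Set V}, T ⊆ X₁ → T' ⊆ X₂ → Disjoint T T' := fun h h' => hX.mono h h'
  have x3' : M ∪ F₃ ⊆ X₁ := Set.union_subset s.M_sub x3
  have x4' : M' ∪ F₄ ⊆ X₂ := Set.union_subset s'.M_sub x4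
  -- Only edges without a common end need disjoint sets. Thus `P₁`, the edge between `w k₁` and `w
  -- k₂`, may meet `M` and `M'`, which belong to edges at `w k₁` and `w k₂`.
  refine not_isPlanarGraph_of_completeBipartite ![w k₁, p n₂, p n₄] ![w k₂, p n₁, p n₃]
    ![![P₁, F₁, M ∪ F₃], ![F₂, p '' Set.Icc n₂ n₁, p '' Set.Icc n₃ n₂],
      ![M' ∪ F₄, W, p '' Set.Icc n₄ n₃]] ?_ ?_
  · have up : ∀ {X u v}, H.JoinedWithin X u v → G.JoinedWithin X u v := fun h =>
      h.mono_graph f.config.le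
    intro a b
    fin_cases a <;> fin_cases b
    · exact f.config.conn₁ _ (f.config.Z_subset s.u_mem_Z) _ (f.config.Z_subset s'.u_mem_Z)
    · exact up (s.F_conn _ s.u_mem_F _ s.z_mem_F)
    · exact (s.M_conn.union (s.F_conn'.mono_graph f.config.le) s.u_mem_M' s.u_mem_F') _
        (.inl s.u_mem_M) _ (.inr s.z_mem_F')
    · exact up (s'.F_conn _ s'.z_mem_F _ s'.u_mem_F)
    · exact arc_joined n21.le hn₁.2
    · exact (arc_joined n32.le hn₂.2).symm
    · exact (s'.M_conn.union (s'.F_conn'.mono_graph f.config.le) s'.u_mem_M' s'.u_mem_F') _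
        (.inr s'.z_mem_F') _ (.inl s'.u_mem_M)
    · exact up (hW _ (.inl (.inl (.inr ⟨n₄, ⟨hn₄.1, le_rfl⟩, rfl⟩))) _
        (.inr (.inr ⟨n₁, ⟨le_rfl, hn₁.2⟩, rfl⟩)))
    · exact arc_joined n43.le hn₃.2
  · have row₁ : ∀ b c : Fin 3, b ≠ c → Disjoint (![P₁, F₁, M ∪ F₃] b)
        (![F₂, p '' Set.Icc n₂ n₁, p '' Set.Icc n₃ n₂] c) := by
      intro b c hbc
      fin_cases b <;> fin_cases c <;> first | exact (hbc rfl).elim | skip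
      · exact P₁_arc (by omega) (by omega)
      · exact P₁_arc (by omega) (by omega)
      · exact span_span x1 x2
      · exact arc_disj s.M_disj (by omega) (by omega) (by omega) (by omega) s.F_sub
      · exact span_span x3' x2
      · exact arc_disj s.M_disj (by omega) (by omega) (by omega) (by omega) sub3
    have row₂ : ∀ b c : Fin 3, b ≠ c → Disjoint (![P₁, F₁, M ∪ F₃] b)
        (![M' ∪ F₄, W, p '' Set.Icc n₄ n₃] c) := by
      intro b c hbc
      fin_cases b <;> fin_cases c <;> first | exact (hbc rfl).elim | skip
      · exact P₁_W
      · exact P₁_arc (by omega) (by omega)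
      · exact span_span x1 x4'
      · exact arc_disj s.M_disj (by omega) (by omega) (by omega) (by omega) s.F_sub
      · exact span_span x3' x4'
      · exact arc_W s.M_disj hMP (by omega) (by omega) sub3
    have row₃ : ∀ b c : Fin 3, b ≠ c →
        Disjoint (![F₂, p '' Set.Icc n₂ n₁, p '' Set.Icc n₃ n₂] b)
        (![M' ∪ F₄, W, p '' Set.Icc n₄ n₃] c) := by
      intro b c hbc
      fin_cases b <;> fin_cases c <;> first | exact (hbc rfl).elim | skip
      · exact arc_W s'.M_disj hMP' (by omega) (by omega) s'.F_sub
      · exact arc_disj s'.M_disj (by omega) (by omega) (by omega) (by omega) s'.F_sub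
      · exact (arc_disj s'.M_disj (by omega) (by omega) (by omega) (by omega) sub4).symm
      · exact (arc_arc n32 (by omega)).symm
      · exact (arc_disj s'.M_disj (by omega) (by omega) (by omega) (by omega) sub4).symm
      · exact mid_W
    intro a c b d hac hbd
    fin_cases a <;> fin_cases c <;> first | exact (absurd hac (by decide)) | skip
    · exact row₁ b d hbd
    · exact row₂ b d hbd
    · exact row₃ b d hbd

end

end IsFrame

/-! ### Assembly -/

/-- With a cross of `w 3, …, w (t - 2)` in `G`, the configuration is not planar. -/
theorem CrossConfig.not_isPlanarGraph {V : Type*} {G H : SimpleGraph V} {BV Z P₁ : Set V}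
    {w p g : ℕ → V} {t N m l : ℕ} (h : CrossConfig G H BV Z P₁ w p g t N m l)
    {q r : ℕ → V} {n n' a b c d : ℕ} (ha : 3 ≤ a) (hab : a < b) (hbc : b < c) (hcd : c < d)
    (hdt : d + 2 ≤ t) (hq : ∀ k < n, G.Adj (q k) (q (k + 1))) (hr : ∀ k < n', G.Adj (r k) (r (k + 1)))
    (hqi : Set.InjOn q (Set.Iic n)) (hri : Set.InjOn r (Set.Iic n'))
    (hqr : ∀ i ≤ n, ∀ j ≤ n', q i ≠ r j) (hqa : q 0 = w a) (hqc : q n = w c) (hrd : r 0 = w d)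
    (hrb : r n' = w b) : ¬ IsPlanarGraph G := by
  have htN := h.ht
  set X := q '' Set.Iic n with hX
  set Y := r '' Set.Iic n' with hY
  have hXY : Disjoint X Y := by
    rw [Set.disjoint_left]
    rintro _ ⟨i, hi, rfl⟩ ⟨j, hj, e⟩
    exact hqr i hi j hj e.symm
  have conn : ∀ {q : ℕ → V} {n : ℕ}, (∀ k < n, G.Adj (q k) (q (k + 1))) →
      G.ConnOn (q '' Set.Iic n) := by
    intro q n hq
    have : Set.Iic n = Set.Icc 0 n := by ext; simp
    rw [this]
    exact connOn_image_Icc fun k _ hk => hq k hk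
  obtain ⟨⟨_, ⟨k, hk, rfl⟩, hkZ⟩, _, ⟨k', hk', rfl⟩, hkZ'⟩ := h.exists_mem_Z (X := X) (Y := Y)
    (by omega) hab hbc hcd (by omega) hXY (conn hq) (conn hr) ⟨0, Nat.zero_le _, hqa⟩
    ⟨n, Set.mem_Iic.2 le_rfl, hqc⟩ ⟨n', Set.mem_Iic.2 le_rfl, hrb⟩ ⟨0, Nat.zero_le _, hrd⟩
  obtain ⟨α, hα, i, hαi, hL⟩ := h.exists_isLeg hq hqa ha (by omega) ⟨k, hk, hkZ⟩
  obtain ⟨β, hβ, i', hβi, hR⟩ := h.exists_isLeg hr hrd (by omega) hdt ⟨k', hk', hkZ'⟩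
  set L := q '' Set.Iio α with hLdef
  set R := r '' Set.Iio β with hRdef
  have f : IsFrame G H BV Z P₁ w p g t N m l L R X Y i i' a d :=
    ⟨h, hL, hR, ha, by omega, hdt, hXY⟩
  set S := IsFrame.verts p L R i i' with hS
  have hSZ : ∀ x ∈ S, x ∉ Z := fun x hx hZ => f.verts_notMem_P₁ x hx (h.Z_subset hZ)
  have leg_step : ∀ {q : ℕ → V} {n α : ℕ}, Set.InjOn q (Set.Iic n) → α ≤ n →
      q '' Set.Iio α ⊆ S → q α ∈ S → ∀ k ≤ n, q k ∈ q '' Set.Iio α →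
      (k < n → q (k + 1) ∈ S) ∧ (0 < k → q (k - 1) ∈ S) := by
    intro q n α hqi hα hLS hαS k hk hkL
    obtain ⟨k', hk', e⟩ := hkL
    have hk'α : k' < α := hk'
    obtain rfl := hqi (Set.mem_Iic.2 (by omega)) hk e
    refine ⟨fun _ => ?_, fun _ => hLS ⟨k' - 1, Set.mem_Iio.2 (by omega), rfl⟩⟩
    rcases (Nat.succ_le_of_lt hk'α).lt_or_eq with h1 | h1
    · exact hLS ⟨k' + 1, h1, rfl⟩
    · rwa [← h1] at hαS
  have hend : ∀ e, a < e → e < d → w e ∈ BV ∧ w e ∉ Z ∧ ∀ F z, H.ConnOn F → w e ∈ F → z ∈ F →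
      z ∈ Z → ∃ x ∈ F, x ∈ S := fun e h1 h2 =>
    ⟨h.w_mem e ⟨by omega, by omega⟩, h.w_notMem (by omega) (by omega),
      fun F z hF heF hzF hz => f.exists_mem_verts h1 h2 hF heF hzF hz⟩
  have joinedX : (H ⊔ spanGraph G H Z S (p '' Set.Icc i i') X).JoinedWithin X (w a) (w c) := by
    rw [← hqa, ← hqc]
    obtain ⟨h1, h2, h3⟩ := hend c (by omega) hcd
    rw [← hqc] at h1 h2 h3
    refine h.joinedWithin_spanGraph hq hqi (.inl (.inl (hqa ▸ hL.u_mem))) f.verts_mem_BV hSZ ?_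
      h1 h2 h3
    -- A frame vertex of `q` off the arc of `p` lies on the leg `L`, since `R ⊆ Y`. Its neighbours
    -- on `q` are on `L` or are `p i`.
    rintro k hk ((hkS | hkS) | hkS) hk0
    · exact leg_step hqi hα (fun x hx => .inl (.inl hx))
        (.inl (.inr ⟨i, ⟨le_rfl, f.i_lt.le⟩, hαi.symm⟩)) k hk hkS
    · exact (hk0 hkS).elim
    · exact (Set.disjoint_left.1 hXY ⟨k, hk, rfl⟩ (hR.sub hkS)).elim
  have joinedY : (H ⊔ spanGraph G H Z S (p '' Set.Icc i i') Y).JoinedWithin Y (w d) (w b) := by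
    rw [← hrd, ← hrb]
    obtain ⟨h1, h2, h3⟩ := hend b hab (by omega)
    rw [← hrb] at h1 h2 h3
    refine h.joinedWithin_spanGraph hr hri (.inr (hrd ▸ hR.u_mem)) f.verts_mem_BV hSZ ?_
      h1 h2 h3
    rintro k hk ((hkS | hkS) | hkS) hk0
    · exact (Set.disjoint_left.1 hXY (hL.sub hkS) ⟨k, hk, rfl⟩).elim
    · exact (hk0 hkS).elim
    · exact leg_step hri hβ (fun x hx => .inr hx)
        (.inl (.inr ⟨i', ⟨f.i_lt.le, le_rfl⟩, hβi.symm⟩)) k hk hkS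
  have far : ∀ {X : Set V} (x y : V), (spanGraph G H Z S (p '' Set.Icc i i') X).Adj x y →
      ∃ k, d < k ∧ k ≤ N ∧ x = w k := by
    rintro X x y ⟨_, _, _, _, _, s⟩
    have hx := s.u_mem_Z
    rw [h.Z_eq] at hx
    obtain ⟨k, hk, rfl⟩ := hx
    exact ⟨k, by have := hk.1; omega, hk.2, rfl⟩
  have le_of_mem : ∀ k, d < k → k ≤ N → w k ∈ Z → t ≤ k := by
    intro k hdk hkN hkZ
    by_contra! hlt
    exact h.w_notMem (by omega) hlt hkZ
  intro hplanar
  -- Cross-freeness with the virtual edges of both paths leaves only the case of two interleaved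
  -- virtual edges, and those give a `K₃,₃`.
  refine h.crossFree X Y _ _ a b c d (by omega) hab hbc hcd (by omega) hXY far far ?_ ?_ joinedX
    joinedY.symm
  · rintro k₁ k₂ k₃ k₄ hdk h12 h23 h34 h4N ⟨_, _, _, _, _, s⟩ ⟨_, _, _, _, _, s'⟩
    exact f.not_isPlanarGraph hXY h12 h23 h34 (le_of_mem _ hdk (by omega) s.u_mem_Z) h4N s s'
      hplanar
  · rintro k₁ k₂ k₃ k₄ hdk h12 h23 h34 h4N ⟨_, _, _, _, _, s⟩ ⟨_, _, _, _, _, s'⟩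
    exact f.not_isPlanarGraph hXY.symm h12 h23 h34 (le_of_mem _ hdk (by omega) s.u_mem_Z) h4N s s'
      hplanar

theorem IsGraphSeparation.adj_right {V : Type*} {G : SimpleGraph V} {A B : G.Subgraph}
    (h : IsGraphSeparation A B) {u x : V} (hadj : G.Adj u x) (hu : u ∈ B.verts)
    (hu' : u ∉ (A ⊓ B).verts) : B.Adj u x := by
  have : (A ⊔ B).Adj u x := by rw [h.1]; exact hadj
  rcases this with hA | hB
  · exact (hu' ⟨hA.fst_mem, hu⟩).elim
  · exact hB

theorem SimpleGraph.Walk.adj_getVert_of_toSubgraph_le {V : Type*} {G : SimpleGraph V}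
    {B : G.Subgraph} {u v : V} {P : G.Walk u v} (h : P.toSubgraph ≤ B) {i : ℕ}
    (hi : i < P.length) : B.Adj (P.getVert i) (P.getVert (i + 1)) :=
  h.2 (P.toSubgraph_adj_getVert hi)

theorem theorem5p3 {V : Type*} [Finite V] (G : SimpleGraph V) (A B : G.Subgraph)
    (hAB : IsGraphSeparation A B)
    -- the closed disc and the drawing of `B` in it
    {D : Type*} [TopologicalSpace D] (φ : UnitDisc ≃ₜ D) (δ : GraphDrawing B.coe D)
    (T : ℕ) (v : ℕ → B.verts) (hv : δ.BoundaryInOrder φ T v)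
    (hint : δ.EdgesInInterior φ)
    (t : ℕ) (htT : t ≤ T)
    (hABverts : (A ⊓ B).verts = insert (v 1 : V) ((fun i => (v i : V)) '' Set.Icc t T))
    -- the three paths
    (P₁ : G.Walk (v 1 : V) (v t : V)) (P₂ : G.Walk (v 2 : V) (v (t - 1) : V))
    (P₃ : G.Walk (v 3 : V) (v (t - 2) : V))
    (hP₁ : P₁.IsPath) (hP₂ : P₂.IsPath) (hP₃ : P₃.IsPath)
    (h₁₂ : List.Disjoint P₁.support P₂.support)
    (h₁₃ : List.Disjoint P₁.support P₃.support)
    (h₂₃ : List.Disjoint P₂.support P₃.support)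
    (hP₁AB : P₁.toSubgraph ≤ A ⊔ B) (hP₂B : P₂.toSubgraph ≤ B) (hP₃B : P₃.toSubgraph ≤ B)
    (hABP₁ : ∀ x ∈ (A ⊓ B).verts, x ∈ P₁.support)
    -- the two crossing paths
    (a b c d : ℕ) (ha : 3 ≤ a) (hab : a < b) (hbc : b < c) (hcd : c < d) (hd : d ≤ t - 2)
    (Q : G.Walk (v a : V) (v c : V)) (R : G.Walk (v b : V) (v d : V))
    (hQ : Q.IsPath) (hR : R.IsPath) (hQR : List.Disjoint Q.support R.support) :
    ¬ IsPlanarGraph G := by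
  obtain ⟨g, ξ, hg⟩ := hv.exists_halfPlaneDrawing hint (by omega)
  set w' : ℕ → B.verts := fun k => if k = T + 1 then v 1 else v k with hw'
  have hw : ∀ k ≤ T, (w' k : V) = v k := fun k hk => by
    rw [hw']; simp only [if_neg (show k ≠ T + 1 by omega)]
  have hwT : (w' (T + 1) : V) = v 1 := by rw [hw']; simp only [if_true]
  have hZ : (A ⊓ B).verts = (fun k => (w' k : V)) '' Set.Icc t (T + 1) := by
    rw [hABverts]
    ext x
    constructor
    · rintro (rfl | ⟨k, hk, rfl⟩)
      · exact ⟨T + 1, ⟨by omega, le_rfl⟩, hwT⟩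
      · exact ⟨k, ⟨hk.1, by have := hk.2; omega⟩, hw k hk.2⟩
    · rintro ⟨k, hk, rfl⟩
      rcases hk.2.lt_or_eq with hk' | rfl
      · exact .inr ⟨k, ⟨hk.1, by omega⟩, (hw k (by omega)).symm⟩
      · exact .inl hwT
  have hconfig : CrossConfig G B.spanningCoe B.verts (A ⊓ B).verts {x | x ∈ P₁.support}
      (fun k => (w' k : V)) P₂.getVert P₃.getVert t (T + 1) P₂.length P₃.length := by
    refine ⟨B.spanningCoe_le, fun u x hadj hu hu' => hAB.adj_right hadj hu hu',
      fun u x hadj => hadj.snd_mem, hg.isCrossFree, ?_, by omega, hZ, fun k _ => (w' k).2, ?_,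
      hABP₁, fun i hi => Walk.adj_getVert_of_toSubgraph_le hP₂B hi, hP₂.getVert_injOn, ?_, ?_,
      fun i hi => Walk.adj_getVert_of_toSubgraph_le hP₃B hi, ?_, ?_,
      fun i _ hi => h₁₂ hi (P₂.getVert_mem_support i),
      fun i _ hi => h₁₃ hi (P₃.getVert_mem_support i),
      fun i _ j _ e => h₂₃ (P₂.getVert_mem_support i) (e ▸ P₃.getVert_mem_support j)⟩
    · exact fun i hi j hj e => hg.injOn_index hi hj (Subtype.ext e)
    · have : {x | x ∈ P₁.support} = P₁.getVert '' Set.Icc 0 P₁.length := by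
        ext x
        simp only [Set.mem_ofPred_eq, Walk.mem_support_iff_exists_getVert, Set.mem_image,
          Set.mem_Icc]
        exact ⟨fun ⟨i, h1, h2⟩ => ⟨i, ⟨Nat.zero_le _, h2⟩, h1⟩, fun ⟨i, h1, h2⟩ => ⟨i, h2, h1.2⟩⟩
      rw [this]
      exact connOn_image_Icc fun k _ hk => P₁.adj_getVert_succ hk
    · rw [Walk.getVert_zero, hw 2 (by omega)]
    · rw [Walk.getVert_length, hw (t - 1) (by omega)]
    · rw [Walk.getVert_zero, hw 3 (by omega)]
    · rw [Walk.getVert_length, hw (t - 2) (by omega)]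
  -- `R` is reversed so that its leg starts at `w d`, the outer end of the cross opposite to `w a`.
  refine hconfig.not_isPlanarGraph (q := Q.getVert) (r := R.reverse.getVert) (n := Q.length)
    (n' := R.reverse.length) ha hab hbc hcd (by omega) (fun k hk => Q.adj_getVert_succ hk)
    (fun k hk => R.reverse.adj_getVert_succ hk) hQ.getVert_injOn hR.reverse.getVert_injOn ?_ ?_ ?_
    ?_ ?_
  · intro i _ j _ e
    refine hQR (Q.getVert_mem_support i) ?_
    have := R.reverse.getVert_mem_support j
    rw [Walk.support_reverse, List.mem_reverse] at this
    rwa [e]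
  · rw [Walk.getVert_zero, hw a (by omega)]
  · rw [Walk.getVert_length, hw c (by omega)]
  · rw [Walk.getVert_zero, hw d (by omega)]
  · rw [Walk.getVert_length, hw b (by omega)]
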